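/- Let $\mathcal A=\bigoplus_{j\ge 0}A_j$ be a commutative graded $\mathbb Z$-algebra with identity such that each $A_j$ is free of finite rank. For a finite graph $G$ (loops and multiple edges allowed) with an arbitrary fixed linear ordering of its edge set $E$, and for $s\subseteq E$, let $[G:s]$ be the spanning subgraph of $G$ with edge set $s$, and let $C^s(G)$ be the tensor product over $\mathbb Z$ of copies of $\mathcal A$, one for each connected component of $[G:s]$, graded by total degree. Let $C^i(G)=\bigoplus_{|s|=i}C^s(G)$, and let $d^i:C^i(G)\to C^{i+1}(G)$ be the sum over all pairs $(s,e)$ with $|s|=i$, $e\in E\setminus s$, of $(-1)^{\#\{f\in s:\,f<e\}}$ times the map $C^s(G)\to C^{s\cup\{e\}}(G)$ that is the identity if $e$ joins a component of $[G:s]$ to itself, and that multiplies the two tensor factors of the components joined by $e$ (and is the identity on the others) otherwise. Let $H^i_{\mathcal A}(G)=\ker d^i/\operatorname{im} d^{i-1}$ and let $H^{i,j}_{\mathcal A}(G)$ be its homogeneous part of degree $j$. Let $P_3$ be the triangle. Let $v\ge 3$ and let $G$ be a $v$-gon with non-crossing diagonals: a finite graph obtained from the polygon with $v$ vertices by adding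 edges (diagonals), each joining two distinct vertices of the polygon, such that no two of the diagonals cross when drawn inside the polygon (i.e. the end points of one diagonal never separate those of another on the boundary of the polygon). Then there is an isomorphism of graded abelian groups $$H^{v-2,*}_{\mathcal A}(G)\;\cong\;H^{1,*}_{\mathcal A}(P_3).$$ Moreover, for every $m\ge 1$ and $\mathcal A_m=\mathbb Z[x]/(x^m)$, graded by $\deg x=1$, we have $H^{v-2,m}_{\mathcal A_m}(G)\cong\mathbb Z_m=\mathbb Z/m\mathbb Z$. -/

import Mathlib

open scoped TensorProduct

noncomputable section

namespace GraphCohomology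

variable {α β : Type*}

/-- Adjacency, on the vertices of `G`, in the spanning subgraph `[G : s]` with edge set `s`. -/
def SpanAdj (G : Graph α β) (s : Finset β) (x y : G.vertexSet) : Prop :=
  ∃ e ∈ s, G.IsLink e x y

/-- The set of connected components of `[G : s]`: the quotient of the vertex set of `G` by the
equivalence relation generated by adjacency in `[G : s]`. -/
def Comp (G : Graph α β) (s : Finset β) : Type _ :=
  Quot (SpanAdj G s)

instance (G : Graph α β) (s : Finset β) [Finite G.vertexSet] : Finite (Comp G s) :=
  inferInstanceAs (Finite (Quot _))

instance (G : Graph α β) (s : Finset β) [Finite G.vertexSet] : Fintype (Comp G s) :=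
  Fintype.ofFinite _

instance (G : Graph α β) (s : Finset β) : DecidableEq (Comp G s) :=
  Classical.decEq _

/-- For `s ⊆ t`, the component of `[G : t]` that contains a given component of `[G : s]`. -/
def compMap (G : Graph α β) {s t : Finset β} (h : s ⊆ t) : Comp G s → Comp G t :=
  Quot.map id fun _ _ ⟨e, he, hl⟩ => ⟨e, h he, hl⟩

/-- The group at the vertex `s` of the cube: the tensor product of copies of `A`, one for each
component of `[G : s]`. -/
abbrev State (G : Graph α β) (A : Type*) [CommRing A] (s : Finset β) : Type _ :=
  ⨂[ℤ] _ : Comp G s, A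

/-- The multilinear map behind the per-edge map: the label of a component of `[G : t]` is the
product of the labels of the components of `[G : s]` contained in it. -/
def mergeMultilinear (G : Graph α β) [Finite G.vertexSet] (A : Type*) [CommRing A]
    {s t : Finset β} (h : s ⊆ t) :
    MultilinearMap ℤ (fun _ : Comp G s => A) (State G A t) where
  toFun a := PiTensorProduct.tprod ℤ fun c' => ∏ c with compMap G h c = c', a c
  map_update_add' := by
    intro inst a c x y
    obtain rfl : inst = instDecidableEqComp G s := Subsingleton.elim _ _
    have key : ∀ z : A, (fun c' => ∏ c₁ with compMap G h c₁ = c', Function.update a c z c₁) =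
        Function.update (fun c' => ∏ c₁ with compMap G h c₁ = c', a c₁) (compMap G h c)
          (z * ∏ c₁ ∈ ({c₁ | compMap G h c₁ = compMap G h c} : Finset _) \ {c}, a c₁) := by
      intro z
      funext c'
      by_cases hc : c' = compMap G h c
      · subst hc
        rw [Function.update_self, Finset.prod_update_of_mem (by simp)]
      · rw [Function.update_of_ne hc, Finset.prod_update_of_notMem (by simp [Ne.symm hc])]
    simp only [key, add_mul, MultilinearMap.map_update_add]
  map_update_smul' := by
    intro inst a c n x
    obtain rfl : inst = instDecidableEqComp G s := Subsingleton.elim _ _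
    have key : ∀ z : A, (fun c' => ∏ c₁ with compMap G h c₁ = c', Function.update a c z c₁) =
        Function.update (fun c' => ∏ c₁ with compMap G h c₁ = c', a c₁) (compMap G h c)
          (z * ∏ c₁ ∈ ({c₁ | compMap G h c₁ = compMap G h c} : Finset _) \ {c}, a c₁) := by
      intro z
      funext c'
      by_cases hc : c' = compMap G h c
      · subst hc
        rw [Function.update_self, Finset.prod_update_of_mem (by simp)]
      · rw [Function.update_of_ne hc, Finset.prod_update_of_notMem (by simp [Ne.symm hc])]
    simp only [key, smul_mul_assoc, MultilinearMap.map_update_smul]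

/-- The map of tensor products induced by `s ⊆ t`. If `t = s ∪ {e}`, this is the per-edge map:
the components of `[G : t]` other than the one containing `e` are components of `[G : s]` and keep
their labels; if `e` joins a component to itself, that one keeps its label too (identity map),
and if `e` joins two components, their labels are multiplied. -/
def merge (G : Graph α β) [Finite G.vertexSet] (A : Type*) [CommRing A]
    {s t : Finset β} (h : s ⊆ t) : State G A s →ₗ[ℤ] State G A t :=
  PiTensorProduct.lift (mergeMultilinear G A h)

/-- The sets of `i` edges of `G`, i.e. the vertices of height `i` of the cube. -/
abbrev EdgeSets (G : Graph α β) (i : ℕ) : Type _ :=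
  {s : Finset β // (s : Set β) ⊆ G.edgeSet ∧ s.card = i}

/-- The `i`-th chain group `C^i(G)` (a finite direct sum, since graphs here have finitely many
edges). -/
abbrev Chain (G : Graph α β) (A : Type*) [CommRing A] (i : ℕ) : Type _ :=
  ∀ s : EdgeSets G i, State G A s.1

/-- Removing the edge `e` from a set of `i + 1` edges. -/
def EdgeSets.erase [DecidableEq β] {G : Graph α β} {i : ℕ} (t : EdgeSets G (i + 1)) (e : β)
    (he : e ∈ t.1) : EdgeSets G i :=
  ⟨t.1.erase e, fun _ hx => t.2.1 (Finset.mem_of_mem_erase hx), by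
    rw [Finset.card_erase_of_mem he, t.2.2, Nat.add_sub_cancel]⟩

/-- The differential `d^i : C^i(G) → C^{i+1}(G)`. The edge of the cube from `t \ {e}` to `t` has the
sign `(-1)^k`, where `k` is the number of edges of `t` that precede `e`. -/
def d (G : Graph α β) [Finite G.vertexSet] [LinearOrder β] (A : Type*) [CommRing A] (i : ℕ) :
    Chain G A i →ₗ[ℤ] Chain G A (i + 1) :=
  LinearMap.pi fun t => ∑ e : {e // e ∈ t.1},
    (-1 : ℤ) ^ (t.1.filter (· < e.1)).card •
      (merge G A (Finset.erase_subset e.1 t.1) ∘ₗ LinearMap.proj (t.erase e.1 e.2))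

/-- The homogeneous part of degree `j` of the tensor product at the vertex `s` of the cube. -/
def stateDeg (G : Graph α β) [Finite G.vertexSet] {A : Type*} [CommRing A]
    (𝒜 : ℕ → Submodule ℤ A) (s : Finset β) (j : ℕ) : Submodule ℤ (State G A s) :=
  Submodule.span ℤ {z | ∃ (deg : Comp G s → ℕ) (a : Comp G s → A),
    (∀ c, a c ∈ 𝒜 (deg c)) ∧ ∑ c, deg c = j ∧ PiTensorProduct.tprod ℤ a = z}

/-- `C^{i,j}(G)`, the homogeneous part of degree `j` of the `i`-th chain group. -/
def chainDeg (G : Graph α β) [Finite G.vertexSet] {A : Type*} [CommRing A]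
    (𝒜 : ℕ → Submodule ℤ A) (i j : ℕ) : Submodule ℤ (Chain G A i) :=
  Submodule.pi Set.univ fun s => stateDeg G 𝒜 s.1 j

/-- The coboundaries of height `i`. -/
def coboundaries (G : Graph α β) [Finite G.vertexSet] [LinearOrder β] (A : Type*) [CommRing A] :
    (i : ℕ) → Submodule ℤ (Chain G A i)
  | 0 => ⊥
  | i + 1 => LinearMap.range (d G A i)

/-- The cohomology group `H^i_A(G)`. -/
abbrev H (G : Graph α β) [Finite G.vertexSet] [LinearOrder β] (A : Type*) [CommRing A] (i : ℕ) :
    Type _ :=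
  LinearMap.ker (d G A i) ⧸ (coboundaries G A i).submoduleOf (LinearMap.ker (d G A i))

/-- `H^{i,j}_A(G)`, the homogeneous part of degree `j` of `H^i_A(G)`: the classes of the cocycles
in `C^{i,j}(G)`. -/
def HDeg (G : Graph α β) [Finite G.vertexSet] [LinearOrder β] {A : Type*} [CommRing A]
    (𝒜 : ℕ → Submodule ℤ A) (i j : ℕ) : Submodule ℤ (H G A i) :=
  ((chainDeg G 𝒜 i j).submoduleOf (LinearMap.ker (d G A i))).map (Submodule.mkQ _)

/-- The polygon `P_n`: vertices `0, …, n - 1`, and an edge `i` from `i` to `i + 1` (mod `n`). -/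
def polygon (n : ℕ) : Graph (Fin n) (Fin n) where
  vertexSet := Set.univ
  IsLink e x y := s(x, y) = s(e, finRotate n e)
  edgeSet := Set.univ
  isLink_symm _ _ := ⟨fun _ _ h => Sym2.eq_swap.trans h⟩
  eq_or_eq_of_isLink_of_isLink := by
    intro e x y v w h h'
    have := h.trans h'.symm
    grind [Sym2.eq_iff]
  edge_mem_iff_exists_isLink e := ⟨fun _ => ⟨e, finRotate n e, rfl⟩, fun _ => trivial⟩
  left_mem_of_isLink _ _ _ _ := trivial

instance (n : ℕ) : Finite (polygon n).vertexSet :=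
  inferInstanceAs (Finite (Set.univ : Set (Fin n)))

/-- `G` is a `v`-gon with non-crossing diagonals: its vertices are those of a `v`-gon, numbered
`p 0, …, p (v - 1)` in cyclic order, it has the sides of the `v`-gon as edges, and every further
edge (diagonal) joins two distinct vertices, where no two diagonals cross, i.e. the end points of
one never separate those of another one on the boundary of the `v`-gon. -/
def IsPolygonWithDiagonals (G : Graph α β) (v : ℕ) : Prop :=
  ∃ (p : Fin v → α) (side : Fin v → β),
    Function.Injective p ∧ Set.range p = G.vertexSet ∧
    Function.Injective side ∧ (∀ i, G.IsLink (side i) (p i) (p (finRotate v i))) ∧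
    (∀ e ∉ Set.range side, ∀ x, ¬ G.IsLoopAt e x) ∧
    ∀ e ∉ Set.range side, ∀ e' ∉ Set.range side, ∀ a b c d : Fin v,
      G.IsLink e (p a) (p b) → G.IsLink e' (p c) (p d) → ¬ (a < c ∧ c < b ∧ b < d)

/-- The algebra `A_m = ℤ[x]/(x^m)`. -/
abbrev TruncPoly (m : ℕ) : Type :=
  Polynomial ℤ ⧸ Ideal.span {(Polynomial.X : Polynomial ℤ) ^ m}

/-- The grading of `A_m`: the homogeneous elements of degree `j` are the multiples of `x^j`. -/
def truncPolyDeg (m j : ℕ) : Submodule ℤ (TruncPoly m) :=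
  Submodule.span ℤ {Ideal.Quotient.mk _ (Polynomial.X ^ j)}

end GraphCohomology

end

set_option linter.unusedSectionVars false

noncomputable section

/-! The proof is deletion and contraction. All complexes live in `Labels G A`, families indexed by
every finite set of edges. The pair `(u, E)` stands for the graph with edges `u ∪ E` in which `u` is
contracted. Only sets between `u` and `u ∪ E` count, and the height includes the edges of `u`, so
contracting an edge does not shift the height. Labels at other sets are unconstrained in cocycles
and coboundaries alike, hence vanish in the quotient.

For an edge `e`, the contraction is the subcomplex of labels supported on sets containing `e`, and
the deletion is the quotient. Hence the deletion computes the cohomology where the contraction has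
none (`gradedIso_delete`), and conversely (`gradedIso_contract`).

Three facts give vanishing. A loop kills everything (`relVanishes_of_loop`), since merging along it
is bijective. A pendant edge preserves vanishing (`relVanishes_insert_of_pendant`), since merging
along it has a section compatible with the other merges. By induction on the edges, a graph with at
least one edge has no cohomology from its rank on (`relVanishes_of_card_le`), and a graph made of
two nonempty parts meeting in a cut vertex has none already one height lower (`relVanishes_of_cut`).

Contracting a diagonal pinches the polygon into two parts at a cut vertex, because the other
diagonals do not cross it, or creates a loop if a parallel edge exists. So in height `v - 2` all
diagonals can be deleted. In the bare polygon, deleting a side leaves a path, which has cohomology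
only in its lowest height; so all but three sides can be contracted. What is left is the complex of
a triangle up to signs (`gradedIso_polygon`). Everything commutes with the projections to
homogeneous parts, so the isomorphisms are graded.

For `ℤ[x]/(x^m)`, every 1-chain of degree `m` on the triangle is a cocycle. The coboundary of `x^a ⊗
x^b ⊗ x^c` gives relations that make one class generate (`eq_nsmul_of_cyclic_relation`), and this
class is killed by `m`. That its order is exactly `m` is seen by the residue of `p dq` modulo `m`:
it is well defined on the quotient ring and vanishes on coboundaries by the Leibniz rule
(`residue_cyclic`). -/

namespace GraphCohomology

/-! ### Functoriality of tensor powers of a commutative ring. -/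

section TensorMap

variable {S T U : Type*} [Fintype S] (A : Type*) [CommRing A]

open Classical in
/-- The multilinear map behind `tensorMap`. -/
def tensorMapMultilinear (g : S → T) :
    MultilinearMap ℤ (fun _ : S => A) (⨂[ℤ] _ : T, A) where
  toFun a := PiTensorProduct.tprod ℤ fun t => ∏ c with g c = t, a c
  map_update_add' := by
    intro inst a c x y
    obtain rfl : inst = Classical.decEq S := Subsingleton.elim _ _
    have key : ∀ z : A, (fun t => ∏ c₁ with g c₁ = t, Function.update a c z c₁) =
        Function.update (fun t => ∏ c₁ with g c₁ = t, a c₁) (g c)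
          (z * ∏ c₁ ∈ ({c₁ | g c₁ = g c} : Finset _) \ {c}, a c₁) := by
      intro z
      funext t
      by_cases hc : t = g c
      · subst hc
        rw [Function.update_self, Finset.prod_update_of_mem (by simp)]
      · rw [Function.update_of_ne hc, Finset.prod_update_of_notMem (by simp [Ne.symm hc])]
    simp only [key, add_mul, MultilinearMap.map_update_add]
  map_update_smul' := by
    intro inst a c n x
    obtain rfl : inst = Classical.decEq S := Subsingleton.elim _ _
    have key : ∀ z : A, (fun t => ∏ c₁ with g c₁ = t, Function.update a c z c₁) =
        Function.update (fun t => ∏ c₁ with g c₁ = t, a c₁) (g c)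
          (z * ∏ c₁ ∈ ({c₁ | g c₁ = g c} : Finset _) \ {c}, a c₁) := by
      intro z
      funext t
      by_cases hc : t = g c
      · subst hc
        rw [Function.update_self, Finset.prod_update_of_mem (by simp)]
      · rw [Function.update_of_ne hc, Finset.prod_update_of_notMem (by simp [Ne.symm hc])]
    simp only [key, smul_mul_assoc, MultilinearMap.map_update_smul]

/-- The map of tensor powers of a commutative ring induced by a map of finite index sets: the
label of `t` is the product of the labels on the fibre over `t`. -/
def tensorMap (g : S → T) : (⨂[ℤ] _ : S, A) →ₗ[ℤ] ⨂[ℤ] _ : T, A :=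
  PiTensorProduct.lift (tensorMapMultilinear A g)

open Classical in
@[simp] theorem tensorMap_tprod (g : S → T) (a : S → A) :
    tensorMap A g (PiTensorProduct.tprod ℤ a) =
      PiTensorProduct.tprod ℤ fun t => ∏ c with g c = t, a c := by
  simp [tensorMap, tensorMapMultilinear]

theorem tensorMap_id : tensorMap A (id : S → S) = LinearMap.id := by
  classical
  ext a
  simp only [LinearMap.compMultilinearMap_apply, tensorMap_tprod, LinearMap.id_apply]
  congr 1
  funext t
  rw [Finset.prod_eq_single t] <;> simp +contextual

theorem tensorMap_comp [Fintype T] (f : T → U) (g : S → T) :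
    tensorMap A f ∘ₗ tensorMap A g = tensorMap A (f ∘ g) := by
  classical
  ext a
  simp only [LinearMap.compMultilinearMap_apply, LinearMap.comp_apply, tensorMap_tprod]
  congr 1
  funext t
  rw [← Finset.prod_fiberwise_of_maps_to (s := {c | (f ∘ g) c = t}) (t := {c | f c = t}) (g := g)]
  · refine Finset.prod_congr rfl fun x hx => Finset.prod_congr ?_ fun _ _ => rfl
    ext c
    simp only [Finset.mem_filter, Finset.mem_univ, true_and, Function.comp_apply] at hx ⊢
    constructor
    · rintro rfl; exact ⟨hx, rfl⟩
    · exact fun h => h.2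
  · simp

theorem tensorMap_tensorMap [Fintype T] (f : T → U) (g : S → T) (z : ⨂[ℤ] _ : S, A) :
    tensorMap A f (tensorMap A g z) = tensorMap A (f ∘ g) z := by
  rw [← tensorMap_comp]; rfl

theorem tensorMap_tensorMap_of_leftInverse [Fintype T] {f : T → S} {g : S → T}
    (h : Function.LeftInverse f g) (z : ⨂[ℤ] _ : S, A) :
    tensorMap A f (tensorMap A g z) = z := by
  rw [tensorMap_tensorMap, h.comp_eq_id, tensorMap_id]; rfl

end TensorMap

/-! ### Total degree on tensor powers. -/

section Grading

variable {S T : Type*} [Fintype S] [Fintype T] {A : Type*} [CommRing A]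
  (𝒜 : ℕ → Submodule ℤ A)

/-- The homogeneous part of degree `j` of a tensor power. -/
def tensorDeg (S : Type*) [Fintype S] (j : ℕ) : Submodule ℤ (⨂[ℤ] _ : S, A) :=
  Submodule.span ℤ {z | ∃ (deg : S → ℕ) (a : S → A),
    (∀ c, a c ∈ 𝒜 (deg c)) ∧ ∑ c, deg c = j ∧ PiTensorProduct.tprod ℤ a = z}

variable [GradedAlgebra 𝒜]

open Classical in
/-- The projection of a tensor power to its homogeneous part of degree `j`. -/
def tensorProj (S : Type*) [Fintype S] (j : ℕ) : (⨂[ℤ] _ : S, A) →ₗ[ℤ] ⨂[ℤ] _ : S, A :=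
  ∑ k ∈ Finset.piAntidiag (Finset.univ : Finset S) j,
    PiTensorProduct.map fun c => GradedAlgebra.proj 𝒜 (k c)

/-- On a pure tensor of multidegree `deg`, the summand of index `k` is the identity if `k = deg` and
zero otherwise; `deg` occurs among the indices exactly when its sum is `j`. -/
theorem tensorProj_apply_of_mem {j l : ℕ} {z : ⨂[ℤ] _ : S, A} (hz : z ∈ tensorDeg 𝒜 S l) :
    tensorProj 𝒜 S j z = if l = j then z else 0 := by
  classical
  induction hz using Submodule.span_induction with
  | zero => simp
  | add x y _ _ hx hy => rw [map_add, hx, hy]; split_ifs <;> simp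
  | smul n x _ hx => rw [map_smul, hx]; split_ifs <;> simp
  | mem z hz =>
    obtain ⟨deg, a, ha, rfl, rfl⟩ := hz
    have key : ∀ k : S → ℕ, (PiTensorProduct.map fun c => GradedAlgebra.proj 𝒜 (k c))
        (PiTensorProduct.tprod ℤ a) = if k = deg then PiTensorProduct.tprod ℤ a else 0 := by
      intro k
      rw [PiTensorProduct.map_tprod]
      split_ifs with h
      · subst h
        congr 1
        funext c
        rw [GradedAlgebra.proj_apply, DirectSum.decompose_of_mem_same _ (ha c)]
      · obtain ⟨c, hc⟩ := Function.ne_iff.mp h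
        refine MultilinearMap.map_coord_zero _ c ?_
        rw [GradedAlgebra.proj_apply, DirectSum.decompose_of_mem_ne _ (ha c) (Ne.symm hc)]
    simp only [tensorProj, LinearMap.sum_apply, key]
    simp

theorem tprod_mem_iSup_tensorDeg (a : S → A) :
    PiTensorProduct.tprod ℤ a ∈ ⨆ j, tensorDeg 𝒜 S j := by
  classical
  have h : a = fun c => ∑ i ∈ (DirectSum.decompose 𝒜 (a c)).support,
      (DirectSum.decompose 𝒜 (a c) i : A) := by
    funext c
    exact (DirectSum.sum_support_decompose 𝒜 (a c)).symm
  rw [h, MultilinearMap.map_sum_finset]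
  refine Submodule.sum_mem _ fun k _ => Submodule.mem_iSup_of_mem (∑ c, k c) ?_
  exact Submodule.subset_span ⟨k, _, fun c => SetLike.coe_mem _, rfl, rfl⟩

theorem iSup_tensorDeg : ⨆ j, tensorDeg 𝒜 S j = ⊤ := by
  rw [eq_top_iff, ← PiTensorProduct.span_tprod_eq_top, Submodule.span_le]
  rintro _ ⟨a, rfl⟩
  exact tprod_mem_iSup_tensorDeg 𝒜 a

theorem tensorMap_mem_tensorDeg (g : S → T) {j : ℕ} {z : ⨂[ℤ] _ : S, A}
    (hz : z ∈ tensorDeg 𝒜 S j) : tensorMap A g z ∈ tensorDeg 𝒜 T j := by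
  classical
  induction hz using Submodule.span_induction with
  | zero => simp
  | add x y _ _ hx hy => rw [map_add]; exact add_mem hx hy
  | smul n x _ hx => rw [map_smul]; exact Submodule.smul_mem _ _ hx
  | mem z hz =>
    obtain ⟨deg, a, ha, rfl, rfl⟩ := hz
    rw [tensorMap_tprod]
    refine Submodule.subset_span ⟨fun t => ∑ c with g c = t, deg c, _, fun t => ?_, ?_, rfl⟩
    · exact SetLike.prod_mem_graded _ _ _ fun c _ => ha c
    · exact Finset.sum_fiberwise _ _ _

theorem tensorProj_mem (j : ℕ) (z : ⨂[ℤ] _ : S, A) : tensorProj 𝒜 S j z ∈ tensorDeg 𝒜 S j := by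
  have hz : z ∈ ⨆ j, tensorDeg 𝒜 S j := iSup_tensorDeg (S := S) 𝒜 ▸ Submodule.mem_top
  induction hz using Submodule.iSup_induction' with
  | mem i x hx =>
    rw [tensorProj_apply_of_mem 𝒜 hx]
    split_ifs with h
    · exact h ▸ hx
    · exact zero_mem _
  | zero => simp
  | add x y _ _ hx hy => rw [map_add]; exact add_mem hx hy

/-- Homogeneous elements span and `tensorMap` preserves degree. This makes every later map built
from merges compatible with the grading. -/
theorem tensorMap_tensorProj (g : S → T) (j : ℕ) (z : ⨂[ℤ] _ : S, A) :
    tensorMap A g (tensorProj 𝒜 S j z) = tensorProj 𝒜 T j (tensorMap A g z) := by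
  have hz : z ∈ ⨆ j, tensorDeg 𝒜 S j := iSup_tensorDeg (S := S) 𝒜 ▸ Submodule.mem_top
  induction hz using Submodule.iSup_induction' with
  | mem i x hx =>
    rw [tensorProj_apply_of_mem 𝒜 hx,
      tensorProj_apply_of_mem 𝒜 (tensorMap_mem_tensorDeg 𝒜 g hx)]
    split_ifs <;> simp
  | zero => simp
  | add x y _ _ hx hy => simp only [map_add, hx, hy]

end Grading

/-! ### Connected components of spanning subgraphs. -/

section Components

variable {α β : Type*} (G : Graph α β)

/-- The component of `[G : s]` containing a vertex. -/
def comp (s : Finset β) (x : G.vertexSet) : Comp G s := Quot.mk _ x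

variable {G}

@[simp] theorem compMap_comp {s t : Finset β} (h : s ⊆ t) (x : G.vertexSet) :
    compMap G h (comp G s x) = comp G t x := rfl

theorem exists_comp_eq {s : Finset β} (c : Comp G s) : ∃ x, comp G s x = c := Quot.exists_rep c

theorem comp_eq_mono {s t : Finset β} (h : s ⊆ t) {x y : G.vertexSet}
    (hxy : comp G s x = comp G s y) : comp G t x = comp G t y := by
  simpa using congrArg (compMap G h) hxy

theorem comp_eq_of_isLink {s : Finset β} {e : β} (he : e ∈ s) {x y : G.vertexSet}
    (h : G.IsLink e x y) : comp G s x = comp G s y := Quot.sound ⟨e, he, h⟩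

/-- An invariant of adjacency is constant on components. -/
theorem iff_of_comp_eq {s : Finset β} (P : G.vertexSet → Prop)
    (hP : ∀ x y : G.vertexSet, ∀ e ∈ s, G.IsLink e x y → (P x → P y)) {x y : G.vertexSet}
    (h : comp G s x = comp G s y) : P x ↔ P y :=
  iff_of_eq (congrArg (Quot.lift P fun a b ⟨e, he, hl⟩ =>
    propext ⟨hP a b e he hl, hP b a e he hl.symm⟩) h)

/-- A new edge glues at most the components of its two ends: the disjunction, read as a property of
`y`, is invariant under adjacency through `insert e s`. -/
theorem comp_insert_eq [DecidableEq β] {s : Finset β} {e : β} {a b : G.vertexSet}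
    (h : G.IsLink e a b) {x y : G.vertexSet}
    (hxy : comp G (insert e s) x = comp G (insert e s) y) :
    comp G s x = comp G s y ∨ (comp G s x = comp G s a ∧ comp G s y = comp G s b) ∨
      (comp G s x = comp G s b ∧ comp G s y = comp G s a) := by
  refine (iff_of_comp_eq (fun y => comp G s x = comp G s y ∨
    (comp G s x = comp G s a ∧ comp G s y = comp G s b) ∨
      (comp G s x = comp G s b ∧ comp G s y = comp G s a)) ?_ hxy).1 (Or.inl rfl)
  intro y z f hf hl
  rcases Finset.mem_insert.1 hf with rfl | hf
  · rcases h.eq_and_eq_or_eq_and_eq hl with ⟨h1, h2⟩ | ⟨h1, h2⟩ <;>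
      rw [Subtype.coe_inj] at h1 h2 <;> subst h1 h2 <;> grind
  · rw [comp_eq_of_isLink hf hl]; exact id

theorem compMap_surjective {s t : Finset β} (h : s ⊆ t) :
    Function.Surjective (compMap G h) := by
  intro c
  obtain ⟨x, rfl⟩ := exists_comp_eq c
  exact ⟨comp G s x, rfl⟩

theorem card_comp_mono [Finite G.vertexSet] {s t : Finset β} (h : s ⊆ t) :
    Nat.card (Comp G t) ≤ Nat.card (Comp G s) :=
  Nat.card_le_card_of_surjective _ (compMap_surjective h)

theorem card_comp_lt [Finite G.vertexSet] {s t : Finset β} (h : s ⊆ t) {a b : G.vertexSet}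
    (hs : comp G s a ≠ comp G s b) (ht : comp G t a = comp G t b) :
    Nat.card (Comp G t) < Nat.card (Comp G s) := by
  rw [Nat.card_eq_fintype_card, Nat.card_eq_fintype_card]
  exact Fintype.card_lt_of_surjective_not_injective _ (compMap_surjective h)
    fun hi => hs (hi (by simpa using ht))

end Components

/-! ### The maps along inclusions of edge sets. -/

section Merge

variable {α β : Type*} (G : Graph α β) [Finite G.vertexSet] (A : Type*) [CommRing A]

theorem merge_eq_tensorMap {s t : Finset β} (h : s ⊆ t) :
    merge G A h = tensorMap A (compMap G h) := by
  classical
  ext a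
  simp only [LinearMap.compMultilinearMap_apply, tensorMap_tprod, merge,
    PiTensorProduct.lift.tprod, mergeMultilinear]
  change PiTensorProduct.tprod ℤ _ = _
  congr! 3

variable {G A}

theorem merge_merge {s t u : Finset β} (h : s ⊆ t) (h' : t ⊆ u) (z : State G A s) :
    merge G A h' (merge G A h z) = merge G A (h.trans h') z := by
  simp only [merge_eq_tensorMap, tensorMap_tensorMap]
  congr 2
  funext c
  obtain ⟨x, rfl⟩ := exists_comp_eq c
  rfl

theorem merge_congr (x : ∀ s, State G A s) {s s' t : Finset β} (hs : s = s') (h : s ⊆ t)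
    (h' : s' ⊆ t) : merge G A h (x s) = merge G A h' (x s') := by
  subst hs; rfl

/-- Merging is bijective if the added edges join no two distinct components. -/
theorem merge_bijective {s t : Finset β} (h : s ⊆ t)
    (hi : ∀ x y : G.vertexSet, ∀ e ∈ t, G.IsLink e x y → comp G s x = comp G s y) :
    Function.Bijective (merge G A h) := by
  let g : Comp G t → Comp G s := Quot.lift (comp G s) fun x y ⟨e, he, hl⟩ =>
    hi x y e he hl
  have h1 : Function.LeftInverse g (compMap G h) := by
    intro c; obtain ⟨x, rfl⟩ := exists_comp_eq c; rfl
  have h2 : Function.LeftInverse (compMap G h) g := by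
    intro c; obtain ⟨x, rfl⟩ := exists_comp_eq c; rfl
  rw [merge_eq_tensorMap]
  exact ⟨Function.LeftInverse.injective (tensorMap_tensorMap_of_leftInverse A h1),
    Function.RightInverse.surjective (tensorMap_tensorMap_of_leftInverse A h2)⟩

/-- A section of the surjection on components induces a section on tensor powers, with label `1` on
the components it misses. -/
theorem merge_surjective {s t : Finset β} (h : s ⊆ t) : Function.Surjective (merge G A h) := by
  have hg := Function.rightInverse_surjInv (compMap_surjective (G := G) h)
  rw [merge_eq_tensorMap]
  exact Function.RightInverse.surjective (tensorMap_tensorMap_of_leftInverse A hg)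

end Merge

/-! ### Signs of the edges of the cube. -/

section Sign

variable {β : Type*} [LinearOrder β]

/-- The sign of the edge of the cube from `t \ {e}` to `t`. -/
def edgeSign (t : Finset β) (e : β) : ℤ := (-1) ^ (t.filter (· < e)).card

theorem edgeSign_mul_self (t : Finset β) (e : β) : edgeSign t e * edgeSign t e = 1 := by
  rw [edgeSign, ← mul_pow]; simp

theorem edgeSign_erase_of_lt {t : Finset β} {e f : β} (h : f < e) :
    edgeSign (t.erase e) f = edgeSign t f := by
  rw [edgeSign, edgeSign, Finset.filter_erase, Finset.erase_eq_of_notMem]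
  simp [h.le]

theorem edgeSign_erase_of_gt {t : Finset β} {e f : β} (he : e ∈ t) (h : e < f) :
    edgeSign (t.erase e) f = -edgeSign t f := by
  have : e ∈ t.filter (· < f) := by simp [he, h]
  rw [edgeSign, edgeSign, Finset.filter_erase, ← Finset.card_erase_add_one this, pow_succ]
  simp

/-- Removing the smaller edge flips the sign at the larger one, and not conversely. This
anticommutation gives `relD_relD`. -/
theorem edgeSign_mul_edgeSign_erase {t : Finset β} {e f : β} (he : e ∈ t) (hf : f ∈ t)
    (hef : e ≠ f) :
    edgeSign t e * edgeSign (t.erase e) f = -(edgeSign t f * edgeSign (t.erase f) e) := by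
  rcases lt_or_gt_of_ne hef with h | h
  · rw [edgeSign_erase_of_gt he h, edgeSign_erase_of_lt h]; ring
  · rw [edgeSign_erase_of_lt h, edgeSign_erase_of_gt hf h]; ring

/-- The same parity argument, in the form needed when a primitive is built by removing a pendant
edge. -/
theorem edgeSign_erase_mul_edgeSign_erase {t : Finset β} {e f : β} (he : e ∈ t) (hf : f ∈ t)
    (hef : e ≠ f) :
    edgeSign (t.erase e) f * edgeSign (t.erase f) e = -(edgeSign t e * edgeSign t f) := by
  rcases lt_or_gt_of_ne hef with h | h
  · rw [edgeSign_erase_of_gt he h, edgeSign_erase_of_lt h]; ring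
  · rw [edgeSign_erase_of_lt h, edgeSign_erase_of_gt hf h]; ring

end Sign

/-! ### The complex relative to contracted edges. -/

section Complex

variable {α β : Type*} (G : Graph α β) (A : Type*) [CommRing A]

/-- Families of labels of all vertices of the cube. -/
abbrev Labels : Type _ := ∀ s : Finset β, State G A s

variable [LinearOrder β] [Finite G.vertexSet]

/-- The differential of the complex of the graph in which the edges in `u` are contracted. -/
def relD (u : Finset β) : Labels G A →ₗ[ℤ] Labels G A :=
  LinearMap.pi fun t => ∑ e ∈ t \ u,
    edgeSign t e • (merge G A (Finset.erase_subset e t) ∘ₗ LinearMap.proj (t.erase e))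

theorem relD_apply (u : Finset β) (x : Labels G A) (t : Finset β) :
    relD G A u x t = ∑ e ∈ t \ u,
      edgeSign t e • merge G A (Finset.erase_subset e t) (x (t.erase e)) := by
  simp [relD]

/-- Cocycles, for the graph with edge set `u ∪ E` in which the edges in `u` are contracted. The
height is the number of edges, those in `u` included. -/
def relCocycles (u E : Finset β) (k : ℕ) : Submodule ℤ (Labels G A) where
  carrier := {x | ∀ t, u ⊆ t → t ⊆ u ∪ E → t.card = k + 1 → relD G A u x t = 0}
  add_mem' := by
    intro x y hx hy t h1 h2 h3
    rw [map_add, Pi.add_apply, hx t h1 h2 h3, hy t h1 h2 h3, add_zero]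
  zero_mem' := by intro t _ _ _; rw [map_zero]; rfl
  smul_mem' := by
    intro n x hx t h1 h2 h3
    rw [map_smul, Pi.smul_apply, hx t h1 h2 h3, smul_zero]

/-- Coboundaries, for the graph with edge set `u ∪ E` in which the edges in `u` are contracted. -/
def relCoboundaries (u E : Finset β) (k : ℕ) : Submodule ℤ (Labels G A) where
  carrier := {x | ∃ y, ∀ t, u ⊆ t → t ⊆ u ∪ E → t.card = k → relD G A u y t = x t}
  add_mem' := by
    rintro x x' ⟨y, hy⟩ ⟨y', hy'⟩
    refine ⟨y + y', fun t h1 h2 h3 => ?_⟩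
    rw [map_add, Pi.add_apply, hy t h1 h2 h3, hy' t h1 h2 h3, Pi.add_apply]
  zero_mem' := ⟨0, fun t _ _ _ => by rw [map_zero]⟩
  smul_mem' := by
    rintro n x ⟨y, hy⟩
    refine ⟨n • y, fun t h1 h2 h3 => ?_⟩
    rw [map_smul, Pi.smul_apply, hy t h1 h2 h3, Pi.smul_apply]

/-- The vanishing of the cohomology of the graph with edge set `u ∪ E` in which the edges in `u`
are contracted. -/
def RelVanishes (u E : Finset β) (k : ℕ) : Prop :=
  relCocycles G A u E k ≤ relCoboundaries G A u E k

variable {G A}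

/-- Each set with two edges removed is reached in two orders, with the same merge and opposite
signs; the terms cancel under the swap of the two edges. -/
theorem relD_relD (u : Finset β) (x : Labels G A) : relD G A u (relD G A u x) = 0 := by
  funext t
  have h : ∀ e ∈ t \ u, edgeSign t e • merge G A (Finset.erase_subset e t)
      (relD G A u x (t.erase e)) = ∑ f ∈ (t.erase e) \ u,
        (edgeSign t e * edgeSign (t.erase e) f) • merge G A
          ((Finset.erase_subset f _).trans (Finset.erase_subset e t))
          (x ((t.erase e).erase f)) := by
    intro e _
    rw [relD_apply, map_sum, Finset.smul_sum]
    refine Finset.sum_congr rfl fun f _ => ?_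
    rw [map_smul, merge_merge, smul_smul]
  rw [relD_apply, Finset.sum_congr rfl h, Finset.sum_sigma']
  refine Finset.sum_involution (fun p _ => ⟨p.2, p.1⟩) ?_ ?_ ?_ ?_
  · rintro ⟨e, f⟩ hp
    simp only [Finset.mem_sigma, Finset.mem_sdiff, Finset.mem_erase] at hp
    dsimp only
    rw [merge_congr x (Finset.erase_right_comm (a := f) (b := e)) _
      ((Finset.erase_subset f _).trans (Finset.erase_subset e t)), ← add_smul,
      edgeSign_mul_edgeSign_erase hp.1.1 hp.2.1.2 (Ne.symm hp.2.1.1)]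
    simp
  · rintro ⟨e, f⟩ hp _
    simp only [Finset.mem_sigma, Finset.mem_sdiff, Finset.mem_erase] at hp
    intro h
    exact hp.2.1.1 (congrArg Sigma.fst h)
  · rintro ⟨e, f⟩ hp
    simp only [Finset.mem_sigma, Finset.mem_sdiff, Finset.mem_erase] at hp ⊢
    tauto
  · rintro ⟨e, f⟩ hp
    rfl

theorem relD_mem_relCocycles (u E : Finset β) (k : ℕ) (y : Labels G A) :
    relD G A u y ∈ relCocycles G A u E k := fun t _ _ _ => by rw [relD_relD]; rfl

theorem relD_mem_relCoboundaries (u E : Finset β) (k : ℕ) (y : Labels G A) :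
    relD G A u y ∈ relCoboundaries G A u E k := ⟨y, fun _ _ _ _ => rfl⟩

theorem relD_congr {u t : Finset β} {x y : Labels G A} 
    (h : ∀ e ∈ t \ u, x (t.erase e) = y (t.erase e)) :
    relD G A u x t = relD G A u y t := by
  rw [relD_apply, relD_apply]
  exact Finset.sum_congr rfl fun e he => by rw [h e he]

/-- This splits the differential into its component from the deletion of `e` and the differential of
the contraction, as in a mapping cone. -/
theorem relD_eq_of_mem {u t : Finset β} {e : β} (heu : e ∉ u) (het : e ∈ t) (x : Labels G A) :
    relD G A u x t = edgeSign t e • merge G A (Finset.erase_subset e t) (x (t.erase e)) +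
      relD G A (insert e u) x t := by
  rw [relD_apply, relD_apply, ← Finset.add_sum_erase _ _ (Finset.mem_sdiff.2 ⟨het, heu⟩)]
  congr 2
  ext f; simp; tauto

variable (G A) in
/-- Extension by zero from the contraction of `e`. -/
def extendByZero (e : β) : Labels G A →ₗ[ℤ] Labels G A :=
  LinearMap.pi fun s => if e ∈ s then LinearMap.proj s else 0

theorem extendByZero_apply (e : β) (x : Labels G A) (s : Finset β) :
    extendByZero G A e x s = if e ∈ s then x s else 0 := by
  simp only [extendByZero, LinearMap.pi_apply]
  split_ifs <;> rfl

/-- The contraction of `e` is a subcomplex: a differential only adds edges, so labels supported on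
sets containing `e` stay so. -/
theorem relD_extendByZero {u : Finset β} {e : β} (heu : e ∉ u) (x : Labels G A) :
    relD G A u (extendByZero G A e x) = extendByZero G A e (relD G A (insert e u) x) := by
  funext t
  rw [extendByZero_apply]
  split_ifs with h
  · rw [relD_eq_of_mem heu h, extendByZero_apply, if_neg (Finset.notMem_erase e t), map_zero,
      smul_zero, zero_add]
    refine relD_congr fun f hf => ?_
    rw [extendByZero_apply, if_pos]
    grind
  · rw [relD_apply]
    refine Finset.sum_eq_zero fun f _ => ?_
    rw [extendByZero_apply, if_neg (fun h' => h (Finset.mem_of_mem_erase h')), map_zero, smul_zero]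

end Complex

/-! ### Vanishing theorems for relative cohomology. -/

section Vanishing

variable {α β : Type*} {G : Graph α β} {A : Type*} [CommRing A]
  [LinearOrder β]

open Classical in
/-- The section of the merging of the components of `a` and `b` with image off the component
of `b`. -/
def splitComp {e : β} {a b : G.vertexSet} (h : G.IsLink e a b) (s : Finset β) :
    Comp G (insert e s) → Comp G s :=
  Quot.lift (fun w => if comp G s w = comp G s b then comp G s a else comp G s w) <| by
    rintro x y ⟨f, hf, hl⟩
    rcases Finset.mem_insert.1 hf with rfl | hf
    · rcases h.eq_and_eq_or_eq_and_eq hl with ⟨h1, h2⟩ | ⟨h1, h2⟩ <;>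
        rw [Subtype.coe_inj] at h1 h2 <;> subst h1 h2 <;> grind
    · simp only [comp_eq_of_isLink hf hl]

open Classical in
theorem splitComp_comp {e : β} {a b : G.vertexSet} (h : G.IsLink e a b) (s : Finset β)
    (w : G.vertexSet) : splitComp h s (comp G (insert e s) w) =
      if comp G s w = comp G s b then comp G s a else comp G s w := rfl

variable [Finite G.vertexSet]

theorem relCocycles_anti {u E E' : Finset β} (h : E ⊆ E') (k : ℕ) :
    relCocycles G A u E' k ≤ relCocycles G A u E k := fun _ hx t h1 h2 h3 =>
  hx t h1 (h2.trans (Finset.union_subset_union_right h)) h3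

theorem relCoboundaries_anti {u E E' : Finset β} (h : E ⊆ E') (k : ℕ) :
    relCoboundaries G A u E' k ≤ relCoboundaries G A u E k := fun _ ⟨y, hy⟩ =>
  ⟨y, fun t h1 h2 h3 => hy t h1 (h2.trans (Finset.union_subset_union_right h)) h3⟩

/-- A cocycle that vanishes on the deletion of `e` is a cocycle of the contraction of `e`. -/
theorem mem_relCocycles_insert {u E : Finset β} {e : β} (heu : e ∉ u) {k : ℕ}
    {x : Labels G A} (hx : x ∈ relCocycles G A u (insert e E) k)
    (h0 : ∀ t, u ⊆ t → t ⊆ u ∪ E → t.card = k → x t = 0) :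
    x ∈ relCocycles G A (insert e u) E k := by
  intro t h1 h2 h3
  have het : e ∈ t := h1 (Finset.mem_insert_self _ _)
  have := hx t ((Finset.subset_insert _ _).trans h1) (by grind) h3
  rwa [relD_eq_of_mem heu het, h0 (t.erase e) (by grind) (by grind)
    (by rw [Finset.card_erase_of_mem het, h3]; rfl), map_zero, smul_zero, zero_add] at this

/-- A coboundary of the contraction of `e` that vanishes on the deletion is a coboundary. -/
theorem mem_relCoboundaries_of_insert {u E : Finset β} {e : β} (heu : e ∉ u) {k : ℕ}
    {x : Labels G A} (hx : x ∈ relCoboundaries G A (insert e u) E k)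
    (h0 : ∀ t, u ⊆ t → t ⊆ u ∪ E → t.card = k → x t = 0) :
    x ∈ relCoboundaries G A u (insert e E) k := by
  obtain ⟨y, hy⟩ := hx
  refine ⟨extendByZero G A e y, fun t h1 h2 h3 => ?_⟩
  rw [relD_extendByZero heu, extendByZero_apply]
  split_ifs with het
  · exact hy t (by grind) (by grind) h3
  · exact (h0 t h1 (by grind) h3).symm

/-- A primitive found on the deletion is used in the whole complex; subtracting its differential
moves the cocycle into the contraction. -/
theorem exists_sub_relD_eq_zero {u E : Finset β} {e : β} {k : ℕ} (h : RelVanishes G A u E k)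
    {x : Labels G A} (hx : x ∈ relCocycles G A u (insert e E) k) :
    ∃ y, ∀ t, u ⊆ t → t ⊆ u ∪ E → t.card = k → (x - relD G A u y) t = 0 := by
  obtain ⟨y, hy⟩ := h (relCocycles_anti (Finset.subset_insert e E) k hx)
  exact ⟨y, fun t h1 h2 h3 => by rw [Pi.sub_apply, hy t h1 h2 h3, sub_self]⟩

/-- Vanishing follows from vanishing on the cocycles supported on the contraction of `e`. -/
theorem relVanishes_insert_of {u E : Finset β} {e : β} {k : ℕ} (heu : e ∉ u)
    (h : RelVanishes G A u E k)
    (h' : ∀ x ∈ relCocycles G A (insert e u) E k,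
      (∀ t, u ⊆ t → t ⊆ u ∪ E → t.card = k → x t = 0) →
        x ∈ relCoboundaries G A u (insert e E) k) :
    RelVanishes G A u (insert e E) k := by
  intro x hx
  obtain ⟨y, hy⟩ := exists_sub_relD_eq_zero h hx
  have h1 := h' _ (mem_relCocycles_insert heu
    (sub_mem hx (relD_mem_relCocycles u _ k y)) hy) hy
  simpa using add_mem h1 (relD_mem_relCoboundaries u _ k y)

/-- The middle term of an exact sequence vanishes when both neighbours, deletion and contraction,
do. -/
theorem relVanishes_insert {u E : Finset β} {e : β} {k : ℕ} (heu : e ∉ u)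
    (h : RelVanishes G A u E k) (h' : RelVanishes G A (insert e u) E k) :
    RelVanishes G A u (insert e E) k :=
  relVanishes_insert_of heu h fun _ hx h0 => mem_relCoboundaries_of_insert heu (h' hx) h0

theorem relVanishes_empty {u : Finset β} {k : ℕ} (h : u.card < k) : RelVanishes G A u ∅ k := by
  refine fun x _ => ⟨0, fun t h1 h2 h3 => ?_⟩
  rw [Finset.union_empty] at h2
  rw [h2.antisymm h1] at h3
  omega

/-- The only set that can occur above the lowest height is `insert e u`, and the merge into it is
surjective. -/
theorem relVanishes_singleton {u : Finset β} {e : β} {k : ℕ} (heu : e ∉ u) (h : u.card < k) :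
    RelVanishes G A u {e} k := by
  rw [← insert_empty_eq e]
  refine relVanishes_insert_of heu (relVanishes_empty h) fun x _ _ => ?_
  obtain ⟨z, hz⟩ := merge_surjective (G := G) (A := A) (Finset.subset_insert e u)
    (edgeSign (insert e u) e • x (insert e u))
  have hins : (insert e u).erase e = u := Finset.erase_insert heu
  refine ⟨Function.update 0 u z, fun t h1 h2 h3 => ?_⟩
  have het : e ∈ t := by
    by_contra het
    have : t = u := by grind
    subst this; omega
  obtain rfl : t = insert e u := by grind
  rw [relD_apply, Finset.insert_sdiff_cancel heu, Finset.sum_singleton,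
    merge_congr (Function.update 0 u z) hins _ (Finset.subset_insert e u), Function.update_self,
    hz, smul_smul, edgeSign_mul_self, one_smul]

/-- The complex is the cone of an isomorphism, merging along `e`. Inverting it gives a primitive `y`
that is correct on sets containing `e`; the cocycle condition and injectivity of the merge force it
to be correct on the others. -/
theorem relVanishes_of_loop {u E : Finset β} {e : β} {k : ℕ} (heu : e ∉ u) (heE : e ∈ E)
    (hl : ∀ x y : G.vertexSet, G.IsLink e x y → comp G u x = comp G u y) :
    RelVanishes G A u E k := by
  have hbij : ∀ s, u ⊆ s → Function.Bijective (merge G A (Finset.subset_insert e s)) := by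
    intro s hs
    refine merge_bijective _ fun x y f hf hxy => ?_
    rcases Finset.mem_insert.1 hf with rfl | hf
    · exact comp_eq_mono hs (hl x y hxy)
    · exact comp_eq_of_isLink hf hxy
  intro x hx
  classical
  let y : Labels G A := fun s => if hs : u ⊆ s ∧ e ∉ s then
    ((hbij s hs.1).2 (edgeSign (insert e s) e • x (insert e s))).choose else 0
  have hy : ∀ s, u ⊆ s → e ∉ s → merge G A (Finset.subset_insert e s) (y s) =
      edgeSign (insert e s) e • x (insert e s) := by
    intro s hs hes
    simp only [y]
    rw [dif_pos ⟨hs, hes⟩]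
    exact ((hbij s hs).2 (edgeSign (insert e s) e • x (insert e s))).choose_spec
  have h1 : ∀ t, u ⊆ t → e ∈ t → (x - relD G A u y) t = 0 := by
    intro t ht het
    have h2 : relD G A (insert e u) y t = 0 := by
      rw [relD_apply]
      refine Finset.sum_eq_zero fun f hf => ?_
      rw [Finset.mem_sdiff, Finset.mem_insert, not_or] at hf
      have : y (t.erase f) = 0 := dif_neg fun h => h.2 (Finset.mem_erase.2 ⟨Ne.symm hf.2.1, het⟩)
      rw [this, map_zero, smul_zero]
    obtain ⟨s, hes, rfl⟩ : ∃ s, e ∉ s ∧ t = insert e s :=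
      ⟨t.erase e, Finset.notMem_erase e t, (Finset.insert_erase het).symm⟩
    rw [Pi.sub_apply, relD_eq_of_mem heu het, h2, add_zero,
      merge_congr y (Finset.erase_insert hes) _ (Finset.subset_insert e s),
      hy s (by rwa [Finset.subset_insert_iff_of_notMem heu] at ht) hes, smul_smul,
      edgeSign_mul_self, one_smul, sub_self]
  refine ⟨y, fun t ht htE htk => ?_⟩
  by_cases het : e ∈ t
  · have := h1 t ht het
    rw [Pi.sub_apply, sub_eq_zero] at this
    exact this.symm
  -- The cocycle condition is read one height up, at `insert e t`, where only the term removing `e`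
  -- can be nonzero.
  have h3 := sub_mem hx (relD_mem_relCocycles u E k y) (insert e t)
    (ht.trans (Finset.subset_insert e t)) (Finset.insert_subset (Finset.mem_union_right u heE) htE)
    (by rw [Finset.card_insert_of_notMem het, htk])
  have h4 : relD G A (insert e u) (x - relD G A u y) (insert e t) = 0 := by
    rw [relD_apply]
    refine Finset.sum_eq_zero fun f hf => ?_
    rw [Finset.mem_sdiff, Finset.mem_insert, Finset.mem_insert, not_or] at hf
    have hfe : e ∈ (insert e t).erase f :=
      Finset.mem_erase.2 ⟨Ne.symm hf.2.1, Finset.mem_insert_self e t⟩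
    have hfu : u ⊆ (insert e t).erase f := Finset.subset_erase.2
      ⟨ht.trans (Finset.subset_insert e t), hf.2.2⟩
    rw [h1 _ hfu hfe, map_zero, smul_zero]
  rw [relD_eq_of_mem heu (Finset.mem_insert_self e t), h4, add_zero,
    merge_congr _ (Finset.erase_insert het) _ (Finset.subset_insert e t)] at h3
  have h5 : merge G A (Finset.subset_insert e t) ((x - relD G A u y) t) = 0 := by
    have := congrArg (fun z => edgeSign (insert e t) e • z) h3
    simpa only [smul_smul, edgeSign_mul_self, one_smul, smul_zero] using this
  have h6 := (hbij t ht).1 (h5.trans (map_zero _).symm)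
  rw [Pi.sub_apply, sub_eq_zero] at h6
  exact h6.symm

theorem merge_tensorMap_splitComp {e : β} {a b : G.vertexSet} (h : G.IsLink e a b)
    (s : Finset β) (z : State G A (insert e s)) :
    merge G A (Finset.subset_insert e s) (tensorMap A (splitComp h s) z) = z := by
  rw [merge_eq_tensorMap]
  refine tensorMap_tensorMap_of_leftInverse A (fun c => ?_) z
  obtain ⟨w, rfl⟩ := exists_comp_eq c
  rw [splitComp_comp]
  split_ifs with hw
  · rw [compMap_comp, comp_eq_of_isLink (Finset.mem_insert_self e s) h]
    exact (comp_eq_mono (Finset.subset_insert e s) hw).symm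
  · rfl

/-- The section puts `1` on the component of `b`. It commutes with a merge that leaves that
component untouched, which is what `hb` says. -/
theorem merge_tensorMap_splitComp_comm {e : β} {a b : G.vertexSet} (h : G.IsLink e a b)
    {s t : Finset β} (hst : s ⊆ t)
    (hb : ∀ w, comp G t w = comp G t b → comp G s w = comp G s b) (z : State G A (insert e s)) :
    merge G A hst (tensorMap A (splitComp h s) z) =
      tensorMap A (splitComp h t) (merge G A (Finset.insert_subset_insert e hst) z) := by
  rw [merge_eq_tensorMap, merge_eq_tensorMap, tensorMap_tensorMap, tensorMap_tensorMap]
  congr 2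
  funext c
  obtain ⟨w, rfl⟩ := exists_comp_eq c
  simp only [Function.comp_apply, compMap_comp, splitComp_comp]
  by_cases hw : comp G s w = comp G s b
  · rw [if_pos hw, if_pos (comp_eq_mono hst hw), compMap_comp]
  · rw [if_neg hw, if_neg (mt (hb w) hw), compMap_comp]

/-- A pendant edge does not affect vanishing. -/
theorem relVanishes_insert_of_pendant {u E : Finset β} {e : β} {k : ℕ} (heu : e ∉ u)
    {a b : G.vertexSet} (hl : G.IsLink e a b)
    (hb : ∀ w, comp G (u ∪ E) w = comp G (u ∪ E) b → comp G u w = comp G u b)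
    (h : RelVanishes G A u E k) : RelVanishes G A u (insert e E) k := by
  refine relVanishes_insert_of heu h fun x hx h0 => ?_
  -- The primitive removes `e`, placing the merged label at `a` and `1` at the pendant end `b`.
  let y : Labels G A := fun s => if e ∈ s then 0 else
    edgeSign (insert e s) e • tensorMap A (splitComp hl s) (x (insert e s))
  have hy0 : ∀ s, e ∈ s → y s = 0 := fun s hs => if_pos hs
  have hy : ∀ s, e ∉ s → y s =
      edgeSign (insert e s) e • tensorMap A (splitComp hl s) (x (insert e s)) :=
    fun s hs => if_neg hs
  refine ⟨y, fun t h1 h2 h3 => ?_⟩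
  by_cases het : e ∈ t
  · have h4 : relD G A (insert e u) y t = 0 := by
      rw [relD_apply]
      refine Finset.sum_eq_zero fun f hf => ?_
      rw [Finset.mem_sdiff, Finset.mem_insert, not_or] at hf
      rw [hy0 _ (Finset.mem_erase.2 ⟨Ne.symm hf.2.1, het⟩), map_zero, smul_zero]
    obtain ⟨s, hes, rfl⟩ : ∃ s, e ∉ s ∧ t = insert e s :=
      ⟨t.erase e, Finset.notMem_erase e t, (Finset.insert_erase het).symm⟩
    rw [relD_eq_of_mem heu het, h4, add_zero,
      merge_congr y (Finset.erase_insert hes) _ (Finset.subset_insert e s),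
      hy s hes, map_smul, merge_tensorMap_splitComp, smul_smul, edgeSign_mul_self, one_smul]
  · have htE : t ⊆ u ∪ E := by
      rwa [Finset.union_insert, Finset.subset_insert_iff_of_notMem het] at h2
    rw [h0 t h1 htE h3]
    have h5 := hx (insert e t) (Finset.insert_subset_insert e h1)
      (Finset.insert_union e u E ▸ Finset.insert_subset_insert e htE)
      (by rw [Finset.card_insert_of_notMem het, h3])
    -- Off `e`, the section turns the differential of `y` into that of `x` in the contraction, where
    -- `x` is a cocycle.
    have h6 : relD G A u y t = -(edgeSign (insert e t) e) • tensorMap A (splitComp hl t)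
        (relD G A (insert e u) x (insert e t)) := by
      have h7 : insert e t \ insert e u = t \ u := by
        rw [Finset.insert_sdiff_insert, Finset.sdiff_insert_of_notMem het]
      rw [relD_apply, relD_apply, h7, map_sum, Finset.smul_sum]
      refine Finset.sum_congr rfl fun f hf => ?_
      have hft : f ∈ t := (Finset.mem_sdiff.1 hf).1
      have hfe : f ≠ e := fun h => het (h ▸ hft)
      rw [hy _ (fun h => het (Finset.mem_of_mem_erase h)), map_smul,
        merge_tensorMap_splitComp_comm hl _ ?_,
        merge_congr x (Finset.erase_insert_of_ne (Ne.symm hfe)).symm _ (Finset.erase_subset f _),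
        map_smul, smul_smul, smul_smul]
      · congr 1
        have := edgeSign_erase_mul_edgeSign_erase (Finset.mem_insert_self e t)
          (Finset.mem_insert_of_mem (a := f) hft) (Ne.symm hfe)
        rw [Finset.erase_insert het, Finset.erase_insert_of_ne (Ne.symm hfe)] at this
        rw [this]; ring
      · intro w hw
        exact comp_eq_mono (Finset.subset_erase.2 ⟨h1, (Finset.mem_sdiff.1 hf).2⟩)
          (hb w (comp_eq_mono htE hw))
    rw [h6, h5, map_zero, smul_zero]

/-- Vanishing above the rank of the graph. -/
theorem relVanishes_of_card_le {E : Finset β} (hE : E.Nonempty) : ∀ {u : Finset β} {k : ℕ},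
    Disjoint u E → Nat.card (Comp G u) + u.card ≤ k + Nat.card (Comp G (u ∪ E)) →
      RelVanishes G A u E k := by
  -- The induction starts at one edge: for `E = ∅` the bound admits the height `u.card`, where all
  -- of `State G A u` survives.
  induction hE using Finset.Nonempty.cons_induction with
  | singleton e =>
    intro u k hd hk
    have heu : e ∉ u := by simpa using hd
    by_cases hl : ∀ x y : G.vertexSet, G.IsLink e x y → comp G u x = comp G u y
    · exact relVanishes_of_loop heu (Finset.mem_singleton_self e) hl
    · push Not at hl
      obtain ⟨a, b, hl, hab⟩ := hl
      have := card_comp_lt (t := u ∪ {e}) (Finset.subset_union_left) hab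
        (comp_eq_of_isLink (by simp) hl)
      exact relVanishes_singleton heu (by omega)
  | cons e E heE hE ih =>
    intro u k hd hk
    rw [Finset.cons_eq_insert] at hd hk ⊢
    have heu : e ∉ u := fun h => Finset.disjoint_left.1 hd h (Finset.mem_insert_self e E)
    by_cases hl : ∀ x y : G.vertexSet, G.IsLink e x y → comp G u x = comp G u y
    · exact relVanishes_of_loop heu (Finset.mem_insert_self e E) hl
    · push Not at hl
      obtain ⟨a, b, hl, hab⟩ := hl
      -- Deletion can only raise the number of final components; contraction lowers the number of
      -- initial ones and adds one to `u.card`. The bound survives both.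
      refine relVanishes_insert heu (ih ?_ ?_) (ih ?_ ?_)
      · exact hd.mono_right (Finset.subset_insert e E)
      · exact hk.trans (Nat.add_le_add_left (card_comp_mono (by grind)) k)
      · rw [Finset.disjoint_left] at hd ⊢; grind
      · have := card_comp_lt (t := insert e u) (Finset.subset_insert e u) hab
          (comp_eq_of_isLink (by simp) hl)
        rw [show insert e u ∪ E = u ∪ insert e E by grind, Finset.card_insert_of_notMem heu]
        omega

/-- Vanishing one step earlier, for a graph with a cut vertex. -/
theorem relVanishes_of_cut {E₂ : Finset β} (hE₂ : E₂.Nonempty) {S₁ S₂ : Set G.vertexSet}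
    {p : G.vertexSet} (h₂ : ∀ e ∈ E₂, ∀ x y : G.vertexSet, G.IsLink e x y → x ∈ S₂)
    {E₁ : Finset β} (hE₁ : E₁.Nonempty) : ∀ {u : Finset β} {k : ℕ},
    (∀ e ∈ E₁, ∀ x y : G.vertexSet, G.IsLink e x y → x ∈ S₁) →
    (∀ x ∈ S₁, ∀ y ∈ S₂, comp G u x = comp G u y → comp G u x = comp G u p) →
    Disjoint E₁ E₂ → Disjoint u (E₁ ∪ E₂) →
    Nat.card (Comp G u) + u.card ≤ k + 1 + Nat.card (Comp G (u ∪ (E₁ ∪ E₂))) →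
      RelVanishes G A u (E₁ ∪ E₂) k := by
  induction hE₁ using Finset.Nonempty.cons_induction with
  | singleton e =>
    intro u k h₁ hp hd₁ hd hk
    have heu : e ∉ u := fun h => Finset.disjoint_left.1 hd h (by simp)
    have heE : e ∉ E₂ := by simpa using hd₁
    by_cases hl : ∀ x y : G.vertexSet, G.IsLink e x y → comp G u x = comp G u y
    · exact relVanishes_of_loop heu (by simp) hl
    -- A non-loop has an end `b` off the component of the cut vertex. Edges of `E₂` cannot reach it,
    -- so `e` is pendant at `b`.
    · have key : ∃ a b : G.vertexSet, G.IsLink e a b ∧ comp G u a ≠ comp G u b ∧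
          comp G u b ≠ comp G u p := by
        push Not at hl
        obtain ⟨a, b, hl, hab⟩ := hl
        by_cases hbp : comp G u b = comp G u p
        · exact ⟨b, a, hl.symm, Ne.symm hab, fun h => hab (h.trans hbp.symm)⟩
        · exact ⟨a, b, hl, hab, hbp⟩
      obtain ⟨a, b, hl, hab, hbp⟩ := key
      have hbS : b ∈ S₁ := h₁ e (Finset.mem_singleton_self e) b a hl.symm
      have hb : ∀ w, comp G (u ∪ E₂) w = comp G (u ∪ E₂) b → comp G u w = comp G u b := by
        intro w hw
        refine (iff_of_comp_eq (fun w => comp G u w = comp G u b) ?_ hw).2 rfl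
        intro x y f hf hxy
        rcases Finset.mem_union.1 hf with hf | hf
        · rw [comp_eq_of_isLink hf hxy]; exact id
        · exact fun hx => absurd (hp b hbS x (h₂ f hf x y hxy) hx.symm) hbp
      rw [Finset.singleton_union] at hd hk ⊢
      refine relVanishes_insert_of_pendant heu hl hb (relVanishes_of_card_le hE₂ ?_ ?_)
      · exact hd.mono_right (Finset.subset_insert _ _)
      -- The pendant edge uses up one unit of rank, which turns the bound with `k + 1` into the one
      -- with `k` required for `E₂`.
      · have := card_comp_lt (s := u ∪ E₂) (t := u ∪ insert e E₂) (by grind)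
          (fun h => hab (hb a h)) (comp_eq_of_isLink (by simp) hl)
        omega
  | cons e E heE hE ih =>
    intro u k h₁ hp hd₁ hd hk
    rw [Finset.cons_eq_insert] at h₁ hd₁ hd hk ⊢
    have heu : e ∉ u := fun h => Finset.disjoint_left.1 hd h (by simp)
    have heE₂ : e ∉ E₂ := fun h => Finset.disjoint_left.1 hd₁ (by simp) h
    by_cases hl : ∀ x y : G.vertexSet, G.IsLink e x y → comp G u x = comp G u y
    · exact relVanishes_of_loop heu (by simp) hl
    · push Not at hl
      obtain ⟨a, b, hl, hab⟩ := hl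
      rw [Finset.insert_union] at hd hk ⊢
      have h₁' := fun f hf => h₁ f (Finset.mem_insert_of_mem hf)
      have hd₁' := hd₁.mono_left (Finset.subset_insert e E)
      refine relVanishes_insert heu (ih h₁' hp hd₁' ?_ ?_) (ih h₁' ?_ hd₁' ?_ ?_)
      · exact hd.mono_right (Finset.subset_insert _ _)
      · exact hk.trans (Nat.add_le_add_left (card_comp_mono (by grind)) _)
      · have ha : a ∈ S₁ := h₁ e (Finset.mem_insert_self e E) a b hl
        have hb : b ∈ S₁ := h₁ e (Finset.mem_insert_self e E) b a hl.symm
        have hc := comp_eq_of_isLink (Finset.mem_insert_self e u) hl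
        -- The cut vertex persists under contraction: if the new edge connects `x` with `y`, then
        -- one of its ends, being in `S₁`, was already in the component of `p`.
        intro x hx y hy hxy
        rcases comp_insert_eq hl hxy with h | ⟨h1, h2⟩ | ⟨h1, h2⟩
        · exact comp_eq_mono (Finset.subset_insert e u) (hp x hx y hy h)
        · have h3 := hp b hb y hy h2.symm
          exact (comp_eq_mono (Finset.subset_insert e u) h1).trans
            (hc.trans (comp_eq_mono (Finset.subset_insert e u) h3))
        · have h3 := hp a ha y hy h2.symm
          exact (comp_eq_mono (Finset.subset_insert e u) h1).trans
            (hc.symm.trans (comp_eq_mono (Finset.subset_insert e u) h3))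
      · rw [Finset.disjoint_left] at hd ⊢; grind
      · have := card_comp_lt (t := insert e u) (Finset.subset_insert e u) hab
          (comp_eq_of_isLink (by simp) hl)
        rw [show insert e u ∪ (E ∪ E₂) = u ∪ insert e (E ∪ E₂) by grind,
          Finset.card_insert_of_notMem heu]
        omega

end Vanishing

/-! ### Isomorphisms of graded subquotients. -/

section GradedIso

/-- Isomorphism of abelian groups with families of homogeneous parts. -/
def GradedIso {M N : Type*} [AddCommGroup M] [AddCommGroup N] (p : ℕ → Submodule ℤ M)
    (q : ℕ → Submodule ℤ N) : Prop :=
  ∃ φ : M ≃ₗ[ℤ] N, ∀ j, (p j).map φ.toLinearMap = q j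

theorem GradedIso.refl {M : Type*} [AddCommGroup M] (p : ℕ → Submodule ℤ M) : GradedIso p p :=
  ⟨LinearEquiv.refl ℤ M, fun j => Submodule.map_id (p j)⟩

theorem GradedIso.symm {M N : Type*} [AddCommGroup M] [AddCommGroup N] {p : ℕ → Submodule ℤ M}
    {q : ℕ → Submodule ℤ N} (h : GradedIso p q) : GradedIso q p := by
  obtain ⟨φ, hφ⟩ := h
  refine ⟨φ.symm, fun j => ?_⟩
  rw [← hφ j, ← Submodule.map_comp]
  simp

theorem GradedIso.trans {M N P : Type*} [AddCommGroup M] [AddCommGroup N] [AddCommGroup P]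
    {p : ℕ → Submodule ℤ M} {q : ℕ → Submodule ℤ N} {r : ℕ → Submodule ℤ P}
    (h : GradedIso p q) (h' : GradedIso q r) : GradedIso p r := by
  obtain ⟨φ, hφ⟩ := h
  obtain ⟨ψ, hψ⟩ := h'
  refine ⟨φ.trans ψ, fun j => ?_⟩
  rw [← hψ j, ← hφ j, ← Submodule.map_comp]
  rfl

/-- The homogeneous part of a subquotient given by a submodule of the ambient module. -/
def subquotientDeg {M : Type*} [AddCommGroup M] (Z B D : Submodule ℤ M) :
    Submodule ℤ (Z ⧸ B.submoduleOf Z) :=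
  (D.submoduleOf Z).map (Submodule.mkQ _)

theorem mem_submoduleOf_iff {M : Type*} [AddCommGroup M] {Z B : Submodule ℤ M} {x : Z} :
    x ∈ B.submoduleOf Z ↔ (x : M) ∈ B := Iff.rfl

/-- The conditions on `f` give an isomorphism of quotients. The projections serve for surjectivity
on homogeneous parts: a preimage of a homogeneous class may be replaced by its degree `j` component.
-/
theorem gradedIso_subquotient {M M' : Type*} [AddCommGroup M] [AddCommGroup M']
    {Z B : Submodule ℤ M} {Z' B' : Submodule ℤ M'} {D : ℕ → Submodule ℤ M}
    {D' : ℕ → Submodule ℤ M'} {π : ℕ → M →ₗ[ℤ] M} {π' : ℕ → M' →ₗ[ℤ] M'}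
    (hD : ∀ j x, π j x ∈ D j) (hD' : ∀ j, ∀ x ∈ D' j, π' j x = x)
    (hfix : ∀ j, ∀ x ∈ D j, π j x = x) (hmem : ∀ j x, π' j x ∈ D' j)
    (hπZ : ∀ j, ∀ x ∈ Z, π j x ∈ Z) (hπB : ∀ j, ∀ x ∈ B', π' j x ∈ B')
    (f : M →ₗ[ℤ] M') (hf : ∀ j x, f (π j x) = π' j (f x))
    (hZ : ∀ x ∈ Z, f x ∈ Z') (hB : ∀ x ∈ Z, f x ∈ B' ↔ x ∈ B)
    (hs : ∀ z' ∈ Z', ∃ z ∈ Z, z' - f z ∈ B') :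
    GradedIso (fun j => subquotientDeg Z B (D j)) (fun j => subquotientDeg Z' B' (D' j)) := by
  let g : Z →ₗ[ℤ] (Z' ⧸ B'.submoduleOf Z') := (Submodule.mkQ _) ∘ₗ f.restrict hZ
  have hg : ∀ z : Z, g z = Submodule.Quotient.mk ⟨f z, hZ z z.2⟩ := fun z => rfl
  have hker : LinearMap.ker g = B.submoduleOf Z := by
    ext z
    rw [LinearMap.mem_ker, hg, Submodule.Quotient.mk_eq_zero, mem_submoduleOf_iff,
      mem_submoduleOf_iff]
    exact hB z z.2
  have hsur : Function.Surjective g := by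
    intro q
    obtain ⟨z', rfl⟩ := Submodule.Quotient.mk_surjective _ q
    obtain ⟨z, hz, h⟩ := hs z' z'.2
    refine ⟨⟨z, hz⟩, ?_⟩
    rw [hg, eq_comm, Submodule.Quotient.eq, mem_submoduleOf_iff]
    exact h
  refine ⟨(Submodule.quotEquivOfEq _ _ hker.symm).trans (g.quotKerEquivOfSurjective hsur),
    fun j => ?_⟩
  have hφ : ∀ z : Z, ((Submodule.quotEquivOfEq _ _ hker.symm).trans
      (g.quotKerEquivOfSurjective hsur)) (Submodule.Quotient.mk z) = g z := fun z => rfl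
  apply le_antisymm
  · rintro _ ⟨_, ⟨z, hz, rfl⟩, rfl⟩
    refine ⟨⟨f z, hZ z z.2⟩, ?_, rfl⟩
    have hz' : (z : M) ∈ D j := hz
    change f z ∈ D' j
    rw [← hfix j z hz', hf]
    exact hmem j _
  · rintro _ ⟨z', hz', rfl⟩
    have hz'' : (z' : M') ∈ D' j := hz'
    obtain ⟨z, hz, h⟩ := hs z' z'.2
    refine ⟨Submodule.Quotient.mk ⟨π j z, hπZ j z hz⟩, ⟨⟨π j z, hπZ j z hz⟩, hD j z, rfl⟩, ?_⟩
    change g _ = Submodule.Quotient.mk z'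
    rw [hg, eq_comm, Submodule.Quotient.eq, mem_submoduleOf_iff]
    change (z' : M') - f (π j z) ∈ B'
    rw [hf, ← hD' j z' hz'', ← map_sub]
    exact hπB j _ h

end GradedIso

/-! ### Deletion and contraction as graded isomorphisms. -/

section Complex

variable {α β : Type*} (G : Graph α β) {A : Type*} [CommRing A]
  [Finite G.vertexSet] (𝒜 : ℕ → Submodule ℤ A)

theorem stateDeg_eq (s : Finset β) (j : ℕ) : stateDeg G 𝒜 s j = tensorDeg 𝒜 (Comp G s) j := rfl

/-- The homogeneous part of degree `j` of the labels of the vertices of the cube. -/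
def labelsDeg (j : ℕ) : Submodule ℤ (Labels G A) :=
  Submodule.pi Set.univ fun s => stateDeg G 𝒜 s j

/-- The homogeneous part of degree `j` of the cohomology of the graph with edge set `u ∪ E` in
which the edges in `u` are contracted. -/
def relHDeg [LinearOrder β] (u E : Finset β) (k j : ℕ) :
    Submodule ℤ (relCocycles G A u E k ⧸
      (relCoboundaries G A u E k).submoduleOf (relCocycles G A u E k)) :=
  subquotientDeg _ _ (labelsDeg G 𝒜 j)

variable [GradedAlgebra 𝒜]

/-- The projection to the homogeneous part of degree `j`. -/
def labelsProj (j : ℕ) : Labels G A →ₗ[ℤ] Labels G A :=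
  LinearMap.pi fun s => tensorProj 𝒜 (Comp G s) j ∘ₗ LinearMap.proj s

variable {G}

theorem labelsProj_apply (j : ℕ) (x : Labels G A) (s : Finset β) :
    labelsProj G 𝒜 j x s = tensorProj 𝒜 (Comp G s) j (x s) := rfl

theorem labelsProj_mem (j : ℕ) (x : Labels G A) : labelsProj G 𝒜 j x ∈ labelsDeg G 𝒜 j :=
  fun s _ => tensorProj_mem 𝒜 j (x s)

theorem labelsProj_of_mem (j : ℕ) (x : Labels G A) (hx : x ∈ labelsDeg G 𝒜 j) :
    labelsProj G 𝒜 j x = x := by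
  funext s
  rw [labelsProj_apply, tensorProj_apply_of_mem 𝒜 (hx s trivial), if_pos rfl]

theorem merge_tensorProj {s t : Finset β} (h : s ⊆ t) (j : ℕ) (z : State G A s) :
    merge G A h (tensorProj 𝒜 (Comp G s) j z) = tensorProj 𝒜 (Comp G t) j (merge G A h z) := by
  rw [merge_eq_tensorMap, tensorMap_tensorProj]

variable [LinearOrder β]

theorem relD_labelsProj (u : Finset β) (j : ℕ) (x : Labels G A) :
    relD G A u (labelsProj G 𝒜 j x) = labelsProj G 𝒜 j (relD G A u x) := by
  funext t
  simp only [labelsProj_apply, relD_apply, map_sum, map_smul, merge_tensorProj]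

theorem labelsProj_mem_relCocycles (u E : Finset β) (k j : ℕ) (x : Labels G A)
    (hx : x ∈ relCocycles G A u E k) : labelsProj G 𝒜 j x ∈ relCocycles G A u E k := by
  intro t h1 h2 h3
  rw [relD_labelsProj, labelsProj_apply, hx t h1 h2 h3, map_zero]

theorem labelsProj_mem_relCoboundaries (u E : Finset β) (k j : ℕ) (x : Labels G A)
    (hx : x ∈ relCoboundaries G A u E k) : labelsProj G 𝒜 j x ∈ relCoboundaries G A u E k := by
  obtain ⟨y, hy⟩ := hx
  refine ⟨labelsProj G 𝒜 j y, fun t h1 h2 h3 => ?_⟩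
  rw [relD_labelsProj, labelsProj_apply, hy t h1 h2 h3, labelsProj_apply]

/-- Homogeneous maps that are isomorphisms on cohomology. -/
theorem gradedIso_rel {u E u' E' : Finset β} {k k' : ℕ} (f : Labels G A →ₗ[ℤ] Labels G A)
    (hf : ∀ j x, f (labelsProj G 𝒜 j x) = labelsProj G 𝒜 j (f x))
    (hZ : ∀ x ∈ relCocycles G A u E k, f x ∈ relCocycles G A u' E' k')
    (hB : ∀ x ∈ relCocycles G A u E k, f x ∈ relCoboundaries G A u' E' k' ↔
      x ∈ relCoboundaries G A u E k)
    (hs : ∀ z' ∈ relCocycles G A u' E' k', ∃ z ∈ relCocycles G A u E k,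
      z' - f z ∈ relCoboundaries G A u' E' k') :
    GradedIso (relHDeg G 𝒜 u E k) (relHDeg G 𝒜 u' E' k') :=
  gradedIso_subquotient (labelsProj_mem 𝒜) (labelsProj_of_mem 𝒜) (labelsProj_of_mem 𝒜)
    (labelsProj_mem 𝒜) (labelsProj_mem_relCocycles 𝒜 u E k)
    (labelsProj_mem_relCoboundaries 𝒜 u' E' k') f hf hZ hB hs

theorem extendByZero_labelsProj (e : β) (j : ℕ) (x : Labels G A) :
    extendByZero G A e (labelsProj G 𝒜 j x) = labelsProj G 𝒜 j (extendByZero G A e x) := by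
  funext s
  rw [labelsProj_apply, extendByZero_apply, extendByZero_apply]
  split_ifs
  · rfl
  · rw [map_zero]

theorem mem_relCoboundaries_of_eq_zero {u E : Finset β} {k : ℕ} {x : Labels G A}
    (h : ∀ t, u ⊆ t → t ⊆ u ∪ E → t.card = k → x t = 0) : x ∈ relCoboundaries G A u E k :=
  ⟨0, fun t h1 h2 h3 => by rw [h t h1 h2 h3, map_zero]; rfl⟩

/-- Deletion of an edge whose contraction has no cohomology. -/
theorem gradedIso_delete {u E : Finset β} {e : β} (heu : e ∉ u) (heE : e ∉ E) {k : ℕ}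
    (h : RelVanishes G A (insert e u) E k) (h' : RelVanishes G A (insert e u) E (k + 1)) :
    GradedIso (relHDeg G 𝒜 u (insert e E) k) (relHDeg G 𝒜 u E k) := by
  have hnot : ∀ t, t ⊆ u ∪ E → e ∉ t := fun t ht het =>
    (Finset.mem_union.1 (ht het)).elim heu heE
  refine gradedIso_rel 𝒜 LinearMap.id (fun _ _ => rfl)
    (fun x hx => relCocycles_anti (Finset.subset_insert e E) k hx)
    (fun x hx => ⟨?_, fun hx => relCoboundaries_anti (Finset.subset_insert e E) k hx⟩) ?_
  -- Injectivity: after subtracting a primitive on the deletion, the rest is a cocycle of the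
  -- contraction, where `h` applies.
  · rintro ⟨y, hy⟩
    have h0 : ∀ t, u ⊆ t → t ⊆ u ∪ E → t.card = k → (x - relD G A u y) t = 0 :=
      fun t h1 h2 h3 => by rw [Pi.sub_apply, hy t h1 h2 h3, LinearMap.id_apply, sub_self]
    have h2 := mem_relCoboundaries_of_insert heu (h (mem_relCocycles_insert heu
      (sub_mem hx (relD_mem_relCocycles u _ k y)) h0)) h0
    simpa using add_mem h2 (relD_mem_relCoboundaries u _ k y)
  · intro z' hz'
    -- Surjectivity: `z'` is extended by zero to sets containing `e`. Its differential is then a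
    -- cocycle of the contraction in height `k + 1`, and a primitive from `h'` corrects the
    -- extension.
    set z₀ := z' - extendByZero G A e z' with hz₀
    have hdel : ∀ t, u ⊆ t → t ⊆ u ∪ E → t.card = k + 1 → relD G A u z₀ t = 0 := by
      intro t h1 h2 h3
      rw [hz₀, map_sub, Pi.sub_apply, hz' t h1 h2 h3, relD_extendByZero heu, extendByZero_apply,
        if_neg (hnot t h2), sub_zero]
    obtain ⟨y, hy⟩ := h' (mem_relCocycles_insert heu
      (relD_mem_relCocycles u (insert e E) (k + 1) z₀) hdel)
    refine ⟨z₀ - extendByZero G A e y, fun t h1 h2 h3 => ?_, ?_⟩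
    · rw [map_sub, Pi.sub_apply, relD_extendByZero heu, extendByZero_apply]
      split_ifs with het
      · rw [hy t (Finset.insert_subset het h1) (by rwa [Finset.insert_union, ← Finset.union_insert])
          h3, sub_self]
      · rw [hdel t h1 (by rwa [Finset.union_insert, Finset.subset_insert_iff_of_notMem het] at h2)
          h3, sub_zero]
    · refine mem_relCoboundaries_of_eq_zero fun t h1 h2 h3 => ?_
      simp [hz₀, extendByZero_apply, hnot t h2]

/-- Contraction of an edge whose deletion has no cohomology. -/
theorem gradedIso_contract {u E : Finset β} {e : β} (heu : e ∉ u) (heE : e ∉ E) {k : ℕ}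
    (h : RelVanishes G A u E k) (h' : RelVanishes G A u E (k + 1)) :
    GradedIso (relHDeg G 𝒜 (insert e u) E (k + 1)) (relHDeg G 𝒜 u (insert e E) (k + 1)) := by
  have hsub : ∀ t, insert e u ⊆ t → t ⊆ insert e u ∪ E → u ⊆ t ∧ t ⊆ u ∪ insert e E ∧ e ∈ t :=
    fun t h1 h2 => ⟨(Finset.subset_insert e u).trans h1,
      by rwa [Finset.union_insert, ← Finset.insert_union], h1 (Finset.mem_insert_self e u)⟩
  have hsub' : ∀ t, u ⊆ t → t ⊆ u ∪ insert e E → e ∈ t →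
      insert e u ⊆ t ∧ t ⊆ insert e u ∪ E := fun t h1 h2 h3 =>
    ⟨Finset.insert_subset h3 h1, by rwa [Finset.insert_union, ← Finset.union_insert]⟩
  have hdel : ∀ t, t ⊆ u ∪ insert e E → e ∉ t → t ⊆ u ∪ E := fun t h2 het => by
    rwa [Finset.union_insert, Finset.subset_insert_iff_of_notMem het] at h2
  refine gradedIso_rel 𝒜 (extendByZero G A e) (extendByZero_labelsProj 𝒜 e) ?_ ?_ ?_
  · intro x hx t h1 h2 h3
    rw [relD_extendByZero heu, extendByZero_apply]
    split_ifs with het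
    · exact hx t (hsub' t h1 h2 het).1 (hsub' t h1 h2 het).2 h3
    · rfl
  · intro x hx
    constructor
    · rintro ⟨y, hy⟩
      -- The differential of `y` is supported on sets containing `e`, so `y` is a cocycle of the
      -- deletion. Subtracting a coboundary makes it vanish there, and what remains is a primitive
      -- in the contraction.
      have hyc : y ∈ relCocycles G A u E k := fun t h1 h2 h3 => by
        rw [hy t h1 (h2.trans (Finset.union_subset_union_right (Finset.subset_insert e E))) h3,
          extendByZero_apply, if_neg]
        intro het
        exact (Finset.mem_union.1 (h2 het)).elim heu heE
      obtain ⟨w, hw⟩ := h hyc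
      refine ⟨y - relD G A u w, fun t h1 h2 h3 => ?_⟩
      obtain ⟨h1', h2', het⟩ := hsub t h1 h2
      have h4 := hy t h1' h2' h3
      rw [extendByZero_apply, if_pos het] at h4
      have h5 : relD G A u (y - relD G A u w) t = x t := by
        rw [map_sub, relD_relD, sub_zero, h4]
      rw [relD_eq_of_mem heu het, Pi.sub_apply, hw (t.erase e), sub_self, map_zero, smul_zero,
        zero_add] at h5
      · exact h5
      · exact Finset.subset_erase.2 ⟨h1', heu⟩
      · exact hdel _ ((Finset.erase_subset e t).trans h2') (Finset.notMem_erase e t)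
      · rw [Finset.card_erase_of_mem het, h3]; rfl
    · rintro ⟨y, hy⟩
      refine ⟨extendByZero G A e y, fun t h1 h2 h3 => ?_⟩
      rw [relD_extendByZero heu, extendByZero_apply, extendByZero_apply]
      split_ifs with het
      · exact hy t (hsub' t h1 h2 het).1 (hsub' t h1 h2 het).2 h3
      · rfl
  · intro z' hz'
    obtain ⟨y, hy⟩ := exists_sub_relD_eq_zero h' hz'
    refine ⟨z' - relD G A u y, mem_relCocycles_insert heu
      (sub_mem hz' (relD_mem_relCocycles u _ _ y)) hy, ?_⟩
    have h4 : z' - relD G A u y - extendByZero G A e (z' - relD G A u y) ∈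
        relCoboundaries G A u (insert e E) (k + 1) := by
      refine mem_relCoboundaries_of_eq_zero fun t h1 h2 h3 => ?_
      rw [Pi.sub_apply, extendByZero_apply]
      split_ifs with het
      · exact sub_self _
      · rw [hy t h1 (hdel t h2 het) h3, sub_zero]
    have h5 := add_mem h4 (relD_mem_relCoboundaries u (insert e E) (k + 1) y)
    rwa [sub_right_comm, sub_add_cancel] at h5

end Complex

/-! ### Comparison with the cohomology groups of the statement. -/

section Comparison

variable {α β : Type*} (G : Graph α β) {A : Type*} [CommRing A]

/-- Restriction of a family of labels to the vertices of height `i` of the cube. -/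
def toChain (G : Graph α β) (A : Type*) [CommRing A] (i : ℕ) :
    Labels G A →ₗ[ℤ] Chain G A i :=
  LinearMap.pi fun s => LinearMap.proj s.1

theorem toChain_surjective (i : ℕ) : Function.Surjective (toChain G A i) := by
  classical
  intro x
  refine ⟨fun s => if h : (s : Set β) ⊆ G.edgeSet ∧ s.card = i then x ⟨s, h⟩ else 0, ?_⟩
  funext s
  exact dif_pos s.2

variable [Finite G.vertexSet] (𝒜 : ℕ → Submodule ℤ A) [GradedAlgebra 𝒜] [LinearOrder β]

theorem d_toChain (i : ℕ) (x : Labels G A) (t : EdgeSets G (i + 1)) :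
    d G A i (toChain G A i x) t = relD G A ∅ x t.1 := by
  rw [relD_apply, Finset.sdiff_empty, ← Finset.sum_coe_sort t.1]
  simp only [d, LinearMap.pi_apply, LinearMap.sum_apply, LinearMap.smul_apply]
  rfl

variable {G}

theorem toChain_mem_ker_iff {E : Finset β} (hE : (E : Set β) = G.edgeSet) {i : ℕ}
    (x : Labels G A) :
    toChain G A i x ∈ LinearMap.ker (d G A i) ↔ x ∈ relCocycles G A ∅ E i := by
  rw [LinearMap.mem_ker]
  constructor
  · intro h t _ h2 h3
    rw [Finset.empty_union] at h2
    have := congrFun h ⟨t, hE ▸ Finset.coe_subset.2 h2, h3⟩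
    rwa [d_toChain] at this
  · intro h
    funext t
    rw [d_toChain]
    refine h t.1 (Finset.empty_subset _) ?_ t.2.2
    rw [Finset.empty_union, ← Finset.coe_subset, hE]
    exact t.2.1

theorem toChain_mem_coboundaries_iff {E : Finset β} (hE : (E : Set β) = G.edgeSet) {i : ℕ}
    (x : Labels G A) :
    toChain G A i x ∈ coboundaries G A i ↔ x ∈ relCoboundaries G A ∅ E i := by
  cases i with
  | zero =>
    -- In height zero the differential is an empty sum, matching the convention that coboundaries
    -- are `⊥`.
    have hD : ∀ y : Labels G A, relD G A ∅ y ∅ = 0 := fun y => by rw [relD_apply]; rfl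
    constructor
    · intro h
      refine mem_relCoboundaries_of_eq_zero fun t _ _ h3 => ?_
      obtain rfl := Finset.card_eq_zero.1 h3
      exact congrFun ((Submodule.mem_bot ℤ).1 h) ⟨∅, by simp, rfl⟩
    · rintro ⟨y, hy⟩
      refine (Submodule.mem_bot ℤ).2 (funext fun s => ?_)
      obtain ⟨s, hs, hs0⟩ := s
      obtain rfl := Finset.card_eq_zero.1 hs0
      exact (hy ∅ (Finset.empty_subset _) (Finset.empty_subset _) rfl).symm.trans (hD y)
  | succ i =>
    constructor
    · rintro ⟨y, hy⟩
      obtain ⟨y, rfl⟩ := toChain_surjective G i y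
      refine ⟨y, fun t _ h2 h3 => ?_⟩
      rw [Finset.empty_union] at h2
      have := congrFun hy ⟨t, hE ▸ Finset.coe_subset.2 h2, h3⟩
      rwa [d_toChain] at this
    · rintro ⟨y, hy⟩
      refine ⟨toChain G A i y, funext fun t => ?_⟩
      rw [d_toChain]
      refine hy t.1 (Finset.empty_subset _) ?_ t.2.2
      rw [Finset.empty_union, ← Finset.coe_subset, hE]
      exact t.2.1

/-- The cohomology of a graph, computed in families of labels. -/
theorem gradedIso_HDeg {E : Finset β} (hE : (E : Set β) = G.edgeSet) (i : ℕ) :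
    GradedIso (relHDeg G 𝒜 ∅ E i) (HDeg G 𝒜 i) := by
  refine gradedIso_subquotient (labelsProj_mem 𝒜)
    (π' := fun j => LinearMap.pi fun s => tensorProj 𝒜 (Comp G s.1) j ∘ₗ LinearMap.proj s)
    (fun j x hx => ?_) (labelsProj_of_mem 𝒜) (fun j x s _ => tensorProj_mem 𝒜 j (x s))
    (labelsProj_mem_relCocycles 𝒜 ∅ E i) (fun j x hx => ?_) (toChain G A i) (fun j x => rfl)
    (fun x => (toChain_mem_ker_iff hE x).2) (fun x _ => toChain_mem_coboundaries_iff hE x) ?_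
  · funext s
    exact (tensorProj_apply_of_mem 𝒜 (hx s trivial)).trans (if_pos rfl)
  · obtain ⟨x, rfl⟩ := toChain_surjective G i x
    rw [toChain_mem_coboundaries_iff hE] at hx
    exact (toChain_mem_coboundaries_iff hE (labelsProj G 𝒜 j x)).2
      (labelsProj_mem_relCoboundaries 𝒜 ∅ E i j x hx)
  · intro z hz
    obtain ⟨z, rfl⟩ := toChain_surjective G i z
    exact ⟨z, (toChain_mem_ker_iff hE z).1 hz, by rw [sub_self]; exact zero_mem _⟩

end Comparison

/-! ### Contracted polygons and their sign corrections. -/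

section Triangle

variable {α β : Type*} [LinearOrder β] {n : ℕ}

/-- After contraction of the edges in `u`, the edges `f i` form a polygon with vertices `q i`. -/
structure IsContractedPolygon (G : Graph α β) (u : Finset β) (q : Fin n → G.vertexSet)
    (f : Fin n → β) : Prop where
  notMem : ∀ i, f i ∉ u
  isLink : ∀ i, ∃ x y : G.vertexSet, G.IsLink (f i) x y ∧ comp G u x = comp G u (q i) ∧
    comp G u y = comp G u (q (finRotate n i))
  injective : Function.Injective fun i => comp G u (q i)
  surjective : ∀ w, ∃ i, comp G u w = comp G u (q i)

variable {G : Graph α β} {u : Finset β} {q : Fin n → G.vertexSet} {f : Fin n → β}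

namespace IsContractedPolygon

theorem comp_eq (h : IsContractedPolygon G u q f) {s : Finset β} (hu : u ⊆ s) {i : Fin n}
    (hi : f i ∈ s) : comp G s (q i) = comp G s (q (finRotate n i)) := by
  obtain ⟨x, y, hl, hx, hy⟩ := h.isLink i
  exact (comp_eq_mono hu hx.symm).trans ((comp_eq_of_isLink hi hl).trans (comp_eq_mono hu hy))

/-- The map of components from the polygon. -/
def fromPolygon (h : IsContractedPolygon G u q f) (s' : Finset (Fin n)) (s : Finset β)
    (hu : u ⊆ s) (hs : ∀ i ∈ s', f i ∈ s) : Comp (polygon n) s' → Comp G s :=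
  Quot.lift (fun i => comp G s (q i.1)) <| by
    rintro x y ⟨i, hi, hl⟩
    have hl' : s(x.1, y.1) = s(i, finRotate n i) := hl
    rcases Sym2.eq_iff.1 hl' with ⟨h1, h2⟩ | ⟨h1, h2⟩
    · rw [h1, h2]; exact h.comp_eq hu (hs i hi)
    · rw [h1, h2]; exact (h.comp_eq hu (hs i hi)).symm

/-- The label of a component of the graph, among the vertices of the polygon. -/
def index (h : IsContractedPolygon G u q f) (w : G.vertexSet) : Fin n := (h.surjective w).choose

theorem comp_index (h : IsContractedPolygon G u q f) (w : G.vertexSet) :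
    comp G u w = comp G u (q (h.index w)) := (h.surjective w).choose_spec

theorem index_eq (h : IsContractedPolygon G u q f) {w : G.vertexSet} {i : Fin n}
    (hw : comp G u w = comp G u (q i)) : h.index w = i :=
  h.injective ((h.comp_index w).symm.trans hw)

/-- The map of components to the polygon. -/
def toPolygon (h : IsContractedPolygon G u q f) (s' : Finset (Fin n)) :
    Comp G (u ∪ s'.image f) → Comp (polygon n) s' :=
  Quot.lift (fun w => comp (polygon n) s' ⟨h.index w, trivial⟩) <| by
    rintro w w' ⟨e, he, hl⟩
    rcases Finset.mem_union.1 he with he | he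
    · congr 2
      exact h.index_eq ((comp_eq_of_isLink he hl).trans (h.comp_index w'))
    · obtain ⟨i, hi, rfl⟩ := Finset.mem_image.1 he
      obtain ⟨x, y, hl', hx, hy⟩ := h.isLink i
      have hP : comp (polygon n) s' ⟨i, trivial⟩ = comp (polygon n) s' ⟨finRotate n i, trivial⟩ :=
        comp_eq_of_isLink hi rfl
      rcases hl'.eq_and_eq_or_eq_and_eq hl with ⟨h1, h2⟩ | ⟨h1, h2⟩ <;>
        rw [Subtype.coe_inj] at h1 h2 <;> subst h1 h2 <;>
        simp only [h.index_eq hx, h.index_eq hy, hP]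

theorem fromPolygon_bijective (h : IsContractedPolygon G u q f) (s' : Finset (Fin n))
    (hu : u ⊆ u ∪ s'.image f) (hs : ∀ i ∈ s', f i ∈ u ∪ s'.image f) :
    Function.LeftInverse (h.toPolygon s') (h.fromPolygon s' _ hu hs) ∧
      Function.LeftInverse (h.fromPolygon s' _ hu hs) (h.toPolygon s') := by
  constructor
  · intro c
    obtain ⟨i, rfl⟩ := exists_comp_eq c
    change comp (polygon n) s' ⟨h.index (q i.1), trivial⟩ = _
    congr 2
    exact h.index_eq rfl
  · intro c
    obtain ⟨w, rfl⟩ := exists_comp_eq c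
    exact (comp_eq_mono hu (h.comp_index w)).symm

variable (A : Type*) [CommRing A] [Finite G.vertexSet]

/-- The map of labels induced by `fromPolygon`. -/
def push (h : IsContractedPolygon G u q f) (s' : Finset (Fin n)) (s : Finset β)
    (hu : u ⊆ s) (hs : ∀ i ∈ s', f i ∈ s) : State (polygon n) A s' →ₗ[ℤ] State G A s :=
  tensorMap A (h.fromPolygon s' s hu hs)

variable {A}

theorem push_bijective (h : IsContractedPolygon G u q f) (s' : Finset (Fin n))
    (hu : u ⊆ u ∪ s'.image f) (hs : ∀ i ∈ s', f i ∈ u ∪ s'.image f) :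
    Function.Bijective (h.push A s' _ hu hs) :=
  ⟨Function.LeftInverse.injective
    (tensorMap_tensorMap_of_leftInverse A (h.fromPolygon_bijective s' hu hs).1),
  Function.RightInverse.surjective
    (tensorMap_tensorMap_of_leftInverse A (h.fromPolygon_bijective s' hu hs).2)⟩

theorem push_congr (h : IsContractedPolygon G u q f) (x : Labels (polygon n) A)
    {s₁ s₂ : Finset (Fin n)} {t : Finset β} (hs : s₁ = s₂) (hu : u ⊆ t) (h₁ : ∀ i ∈ s₁, f i ∈ t)
    (h₂ : ∀ i ∈ s₂, f i ∈ t) : h.push A s₁ t hu h₁ (x s₁) = h.push A s₂ t hu h₂ (x s₂) := by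
  subst hs; rfl

theorem merge_push (h : IsContractedPolygon G u q f) {s' t' : Finset (Fin n)} {s t : Finset β}
    (hu : u ⊆ s) (hs : ∀ i ∈ s', f i ∈ s) (ht : ∀ i ∈ t', f i ∈ t) (hst : s ⊆ t) (hst' : s' ⊆ t')
    (z : State (polygon n) A s') : merge G A hst (h.push A s' s hu hs z) =
      h.push A t' t (hu.trans hst) ht (merge (polygon n) A hst' z) := by
  rw [push, push, merge_eq_tensorMap, merge_eq_tensorMap, tensorMap_tensorMap,
    tensorMap_tensorMap]
  congr 2
  funext c
  obtain ⟨x, rfl⟩ := exists_comp_eq c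
  rfl

end IsContractedPolygon

/-- The edges of the polygon corresponding to edges in `s`. -/
def polygonEdges (f : Fin n → β) (s : Finset β) : Finset (Fin n) := Finset.univ.filter (f · ∈ s)

theorem mem_polygonEdges {s : Finset β} {i : Fin n} : i ∈ polygonEdges f s ↔ f i ∈ s := by
  simp [polygonEdges]

/-- The correction of signs for the contracted edges. -/
def contractSign (u : Finset β) (f : Fin n → β) (s' : Finset (Fin n)) : ℤ :=
  ∏ i ∈ s', (-1) ^ (u.filter (· < f i)).card

theorem contractSign_mul_self (u : Finset β) (f : Fin n → β) (s' : Finset (Fin n)) :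
    contractSign u f s' * contractSign u f s' = 1 := by
  rw [contractSign, ← Finset.prod_mul_distrib]
  exact Finset.prod_eq_one fun i _ => by rw [← mul_pow]; simp

theorem polygonEdges_union_image (hf : Function.Injective f) (hu : ∀ i, f i ∉ u)
    (s' : Finset (Fin n)) : polygonEdges f (u ∪ s'.image f) = s' := by
  ext i
  rw [mem_polygonEdges, Finset.mem_union, hf.mem_finset_image, or_iff_right (hu i)]

theorem union_image_polygonEdges {t : Finset β} (h1 : u ⊆ t)
    (h2 : t ⊆ u ∪ Finset.univ.image f) : u ∪ (polygonEdges f t).image f = t := by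
  ext e
  simp only [Finset.mem_union, Finset.mem_image, mem_polygonEdges]
  constructor
  · rintro (h | ⟨i, hi, rfl⟩)
    · exact h1 h
    · exact hi
  · intro he
    refine (Finset.mem_union.1 (h2 he)).imp id fun h => ?_
    obtain ⟨i, _, rfl⟩ := Finset.mem_image.1 h
    exact ⟨i, he, rfl⟩

theorem card_union_image (hf : Function.Injective f) (hu : ∀ i, f i ∉ u) (s' : Finset (Fin n)) :
    (u ∪ s'.image f).card = u.card + s'.card := by
  rw [Finset.card_union_of_disjoint, Finset.card_image_of_injective _ hf]
  rw [Finset.disjoint_right]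
  simp only [Finset.mem_image]
  rintro _ ⟨i, _, rfl⟩
  exact hu i

/-- The sign at `f i` counts preceding edges of the polygon, in the same number because `f` is
monotone, and preceding edges of `u`. The latter depend only on `i`, so a product over the edges
absorbs them. -/
theorem contractSign_mul_edgeSign (hf : StrictMono f) (hu : ∀ i, f i ∉ u) {s' : Finset (Fin n)}
    {i : Fin n} (hi : i ∈ s') : contractSign u f s' * edgeSign s' i =
      edgeSign (u ∪ s'.image f) (f i) * contractSign u f (s'.erase i) := by
  have h1 : (u ∪ s'.image f).filter (· < f i) =
      u.filter (· < f i) ∪ (s'.filter (· < i)).image f := by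
    rw [Finset.filter_union, Finset.filter_image]
    simp only [hf.lt_iff_lt]
  have h2 : ((u ∪ s'.image f).filter (· < f i)).card =
      (u.filter (· < f i)).card + (s'.filter (· < i)).card := by
    rw [h1]
    exact card_union_image hf.injective (fun j hj => hu j (Finset.mem_filter.1 hj).1) _
  rw [edgeSign, edgeSign, h2, contractSign, ← Finset.mul_prod_erase _ _ hi, contractSign, pow_add]
  ring

variable (A : Type*) [CommRing A] [Finite G.vertexSet]

/-- The map from the complex of the polygon. -/
def pushLabels (h : IsContractedPolygon G u q f) : Labels (polygon n) A →ₗ[ℤ] Labels G A :=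
  LinearMap.pi fun s => if hu : u ⊆ s then contractSign u f (polygonEdges f s) •
    (h.push A (polygonEdges f s) s hu (fun _ hi => mem_polygonEdges.1 hi) ∘ₗ
      LinearMap.proj (polygonEdges f s)) else 0

variable {A}

theorem pushLabels_apply (h : IsContractedPolygon G u q f) (x : Labels (polygon n) A)
    {s : Finset β} (hu : u ⊆ s) : pushLabels A h x s = contractSign u f (polygonEdges f s) •
      h.push A (polygonEdges f s) s hu (fun _ hi => mem_polygonEdges.1 hi)
        (x (polygonEdges f s)) := by
  rw [pushLabels, LinearMap.pi_apply, dif_pos hu]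
  rfl

theorem pushLabels_apply_image (h : IsContractedPolygon G u q f) (hf : Function.Injective f)
    (x : Labels (polygon n) A) (s' : Finset (Fin n)) (hu : u ⊆ u ∪ s'.image f)
    (hs : ∀ i ∈ s', f i ∈ u ∪ s'.image f) :
    pushLabels A h x (u ∪ s'.image f) = contractSign u f s' • h.push A s' _ hu hs (x s') := by
  have := polygonEdges_union_image hf h.notMem s'
  rw [pushLabels_apply h x hu, h.push_congr x this hu _ hs, this]

theorem mem_union_image {s' : Finset (Fin n)} {i : Fin n} (hi : i ∈ s') :
    f i ∈ u ∪ s'.image f := Finset.mem_union_right _ (Finset.mem_image_of_mem f hi)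

theorem relD_pushLabels (h : IsContractedPolygon G u q f) (hf : StrictMono f)
    (x : Labels (polygon n) A) (s' : Finset (Fin n)) :
    relD G A u (pushLabels A h x) (u ∪ s'.image f) =
      pushLabels A h (relD (polygon n) A ∅ x) (u ∪ s'.image f) := by
  have hu : u ⊆ u ∪ s'.image f := Finset.subset_union_left
  have hsd : (u ∪ s'.image f) \ u = s'.image f := by
    rw [Finset.union_sdiff_left, Finset.sdiff_eq_self_iff_disjoint, Finset.disjoint_left]
    simp only [Finset.mem_image]
    rintro _ ⟨i, _, rfl⟩
    exact h.notMem i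
  rw [relD_apply, hsd, Finset.sum_image hf.injective.injOn,
    pushLabels_apply_image h hf.injective _ s' hu (fun _ => mem_union_image), relD_apply,
    Finset.sdiff_empty, map_sum, Finset.smul_sum]
  refine Finset.sum_congr rfl fun i hi => ?_
  have herase : (u ∪ s'.image f).erase (f i) = u ∪ (s'.erase i).image f := by
    rw [Finset.image_erase hf.injective, Finset.erase_union_distrib,
      Finset.erase_eq_of_notMem (h.notMem i)]
  rw [merge_congr _ herase _ (Finset.union_subset_union_right
      (Finset.image_subset_image (Finset.erase_subset i s'))),
    pushLabels_apply_image h hf.injective x (s'.erase i) Finset.subset_union_left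
      (fun _ => mem_union_image), map_smul, map_smul, smul_smul, smul_smul,
    contractSign_mul_edgeSign hf h.notMem hi,
    h.merge_push _ _ (fun _ => mem_union_image) _ (Finset.erase_subset i s')]

theorem pushLabels_eq_iff (h : IsContractedPolygon G u q f) (hf : Function.Injective f)
    (x y : Labels (polygon n) A) (s' : Finset (Fin n)) :
    pushLabels A h x (u ∪ s'.image f) = pushLabels A h y (u ∪ s'.image f) ↔ x s' = y s' := by
  have hu : u ⊆ u ∪ s'.image f := Finset.subset_union_left
  rw [pushLabels_apply_image h hf x s' hu (fun _ => mem_union_image),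
    pushLabels_apply_image h hf y s' hu (fun _ => mem_union_image)]
  constructor
  · intro hxy
    have := congrArg (fun z => contractSign u f s' • z) hxy
    simp only [smul_smul, contractSign_mul_self, one_smul] at this
    exact (h.push_bijective s' hu _).1 this
  · intro hxy
    rw [hxy]

theorem exists_pushLabels_eq (h : IsContractedPolygon G u q f) (hf : Function.Injective f)
    (y : Labels G A) : ∃ x, ∀ s' : Finset (Fin n),
      pushLabels A h x (u ∪ s'.image f) = y (u ∪ s'.image f) := by
  have hu : ∀ s' : Finset (Fin n), u ⊆ u ∪ s'.image f := fun s' => Finset.subset_union_left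
  choose x hx using fun s' : Finset (Fin n) => (h.push_bijective (A := A) s' (hu s')
    (fun _ => mem_union_image)).2 (contractSign u f s' • y (u ∪ s'.image f))
  refine ⟨x, fun s' => ?_⟩
  rw [pushLabels_apply_image h hf x s' (hu s') (fun _ => mem_union_image), hx, smul_smul,
    contractSign_mul_self, one_smul]

/-- The sets between `u` and `u ∪ Finset.univ.image f` correspond to sets of polygon edges, with
heights shifted by `u.card`. -/
theorem forall_interval_iff (h : IsContractedPolygon G u q f) (hf : Function.Injective f)
    (P : Finset β → Prop) (k : ℕ) :
    (∀ t, u ⊆ t → t ⊆ u ∪ Finset.univ.image f → t.card = u.card + k → P t) ↔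
      ∀ s' : Finset (Fin n), s'.card = k → P (u ∪ s'.image f) := by
  constructor
  · intro hP s' hs'
    refine hP _ Finset.subset_union_left (Finset.union_subset_union_right
      (Finset.image_subset_image (Finset.subset_univ s'))) ?_
    rw [card_union_image hf h.notMem, hs']
  · intro hP t h1 h2 h3
    have ht := union_image_polygonEdges h1 h2
    rw [← ht]
    refine hP _ ?_
    rw [← ht, card_union_image hf h.notMem] at h3
    omega

/-- The cohomology of a contracted polygon. -/
theorem gradedIso_polygon (h : IsContractedPolygon G u q f) (hf : StrictMono f)
    (𝒜 : ℕ → Submodule ℤ A) [GradedAlgebra 𝒜] (k : ℕ) :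
    GradedIso (relHDeg (polygon n) 𝒜 ∅ Finset.univ k)
      (relHDeg G 𝒜 u (Finset.univ.image f) (u.card + k)) := by
  have hi := hf.injective
  have hZG : ∀ x : Labels G A, x ∈ relCocycles G A u (Finset.univ.image f) (u.card + k) ↔
      ∀ s' : Finset (Fin n), s'.card = k + 1 → relD G A u x (u ∪ s'.image f) = 0 := fun x =>
    forall_interval_iff h hi (fun t => relD G A u x t = 0) (k + 1)
  have hBG : ∀ x : Labels G A, x ∈ relCoboundaries G A u (Finset.univ.image f) (u.card + k) ↔
      ∃ y, ∀ s' : Finset (Fin n), s'.card = k →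
        relD G A u y (u ∪ s'.image f) = x (u ∪ s'.image f) := fun x =>
    exists_congr fun y => forall_interval_iff h hi (fun t => relD G A u y t = x t) k
  have hZP : ∀ x : Labels (polygon n) A, x ∈ relCocycles (polygon n) A ∅ Finset.univ k ↔
      ∀ s' : Finset (Fin n), s'.card = k + 1 → relD (polygon n) A ∅ x s' = 0 := fun x =>
    ⟨fun hx s' => hx s' (Finset.empty_subset _) (by simp), fun hx s' _ _ => hx s'⟩
  have hBP : ∀ x : Labels (polygon n) A, x ∈ relCoboundaries (polygon n) A ∅ Finset.univ k ↔
      ∃ y, ∀ s' : Finset (Fin n), s'.card = k → relD (polygon n) A ∅ y s' = x s' := fun x =>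
    exists_congr fun y => ⟨fun hx s' => hx s' (Finset.empty_subset _) (by simp),
      fun hx s' _ _ => hx s'⟩
  -- The differential at such a set reads only labels at sets of the same form, so labels elsewhere
  -- are irrelevant.
  have hcongr : ∀ x y : Labels G A, (∀ s' : Finset (Fin n), x (u ∪ s'.image f) =
      y (u ∪ s'.image f)) → ∀ s' : Finset (Fin n),
        relD G A u x (u ∪ s'.image f) = relD G A u y (u ∪ s'.image f) := by
    intro x y hxy s'
    refine relD_congr fun e he => ?_
    rw [Finset.mem_sdiff] at he
    have : u ∪ (polygonEdges f ((u ∪ s'.image f).erase e)).image f = (u ∪ s'.image f).erase e :=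
      union_image_polygonEdges (Finset.subset_erase.2 ⟨Finset.subset_union_left, he.2⟩)
        ((Finset.erase_subset _ _).trans (Finset.union_subset_union_right
          (Finset.image_subset_image (Finset.subset_univ s'))))
    rw [← this]
    exact hxy _
  have hzero : ∀ (x : Labels (polygon n) A) (s' : Finset (Fin n)),
      relD G A u (pushLabels A h x) (u ∪ s'.image f) = 0 ↔ relD (polygon n) A ∅ x s' = 0 := by
    intro x s'
    have := pushLabels_eq_iff h hi (relD (polygon n) A ∅ x) 0 s'
    rwa [map_zero, ← relD_pushLabels h hf] at this
  refine gradedIso_subquotient (labelsProj_mem 𝒜) (labelsProj_of_mem 𝒜) (labelsProj_of_mem 𝒜)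
    (labelsProj_mem 𝒜) (labelsProj_mem_relCocycles 𝒜 _ _ _)
    (labelsProj_mem_relCoboundaries 𝒜 _ _ _) (pushLabels A h) ?_ ?_ ?_ ?_
  · intro j x
    funext s
    by_cases hu : u ⊆ s
    · rw [labelsProj_apply, pushLabels_apply h _ hu, pushLabels_apply h _ hu, map_smul,
        labelsProj_apply, IsContractedPolygon.push, tensorMap_tensorProj]
    · rw [labelsProj_apply, pushLabels, LinearMap.pi_apply, LinearMap.pi_apply, dif_neg hu]
      simp
  · intro x hx
    rw [hZG]
    exact fun s' hs' => (hzero x s').2 ((hZP x).1 hx s' hs')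
  · intro x _
    rw [hBG, hBP]
    constructor
    · rintro ⟨y, hy⟩
      obtain ⟨z, hz⟩ := exists_pushLabels_eq h hi y
      refine ⟨z, fun s' hs' => ?_⟩
      rw [← pushLabels_eq_iff h hi, ← relD_pushLabels h hf, ← hy s' hs']
      exact hcongr _ _ hz s'
    · rintro ⟨y, hy⟩
      refine ⟨pushLabels A h y, fun s' hs' => ?_⟩
      rw [relD_pushLabels h hf, pushLabels_eq_iff h hi, hy s' hs']
  · intro z' hz'
    obtain ⟨z, hz⟩ := exists_pushLabels_eq h hi z'
    refine ⟨z, (hZP z).2 fun s' hs' => ?_, ?_⟩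
    · rw [← hzero, hcongr _ _ hz s']
      exact (hZG z').1 hz' s' hs'
    · refine (hBG _).2 ⟨0, fun s' _ => ?_⟩
      rw [Pi.sub_apply, hz, sub_self, map_zero]
      rfl

end Triangle

/-! ### Removing diagonals and contracting sides. -/

section PolygonWithDiagonals

variable {α β : Type*}

theorem comp_empty_injective (G : Graph α β) : Function.Injective (comp G (∅ : Finset β)) := by
  intro x y h
  exact ((iff_of_comp_eq (fun y => x = y) (fun _ _ e he => absurd he (Finset.notMem_empty e))
    h).1 rfl)

theorem val_finRotate {v : ℕ} (i : Fin v) :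
    ((finRotate v i : Fin v) : ℕ) = if (i : ℕ) + 1 = v then 0 else (i : ℕ) + 1 := by
  obtain _ | n := v
  · exact i.elim0
  · split_ifs with h
    · obtain rfl : i = Fin.last n := Fin.ext (by simpa using h)
      rw [finRotate_last]; rfl
    · rw [coe_finRotate_of_ne_last]
      rintro rfl
      exact h rfl

variable [LinearOrder β] {v : ℕ}

/-- The sides of a polygon from the side `l` on. -/
def sidesFrom (side : Fin v → β) (l : ℕ) : Finset β :=
  (Finset.univ.filter fun i : Fin v => l ≤ i).image side

/-- The sides of a polygon before the side `l`. -/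
def sidesBefore (side : Fin v → β) (l : ℕ) : Finset β :=
  (Finset.univ.filter fun i : Fin v => (i : ℕ) < l).image side

variable {side : Fin v → β}

theorem mem_sidesFrom (hs : Function.Injective side) {l : ℕ} {i : Fin v} :
    side i ∈ sidesFrom side l ↔ l ≤ i := by
  rw [sidesFrom, hs.mem_finset_image]; simp

theorem mem_sidesBefore (hs : Function.Injective side) {l : ℕ} {i : Fin v} :
    side i ∈ sidesBefore side l ↔ (i : ℕ) < l := by
  rw [sidesBefore, hs.mem_finset_image]; simp

theorem exists_of_mem_sidesFrom {l : ℕ} {e : β} (he : e ∈ sidesFrom side l) :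
    ∃ i : Fin v, l ≤ i ∧ side i = e := by simpa [sidesFrom] using he

theorem exists_of_mem_sidesBefore {l : ℕ} {e : β} (he : e ∈ sidesBefore side l) :
    ∃ i : Fin v, (i : ℕ) < l ∧ side i = e := by simpa [sidesBefore] using he

theorem insert_sidesFrom (i : Fin v) :
    insert (side i) (sidesFrom side (i + 1)) = sidesFrom side i := by
  rw [sidesFrom, sidesFrom, ← Finset.image_insert]
  congr 1
  ext j
  simp only [Finset.mem_insert, Finset.mem_filter_univ, Fin.ext_iff]
  omega

theorem insert_sidesBefore (i : Fin v) :
    insert (side i) (sidesBefore side i) = sidesBefore side (i + 1) := by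
  rw [sidesBefore, sidesBefore, ← Finset.image_insert]
  congr 1
  ext j
  simp only [Finset.mem_insert, Finset.mem_filter_univ, Fin.ext_iff]
  omega

theorem card_sidesBefore (hs : Function.Injective side) {l : ℕ} (hl : l ≤ v) :
    (sidesBefore side l).card = l := by
  rw [sidesBefore, Finset.card_image_of_injective _ hs]
  exact Fin.card_filter_val_lt.trans (min_eq_right hl)

variable {G : Graph α β} {p : Fin v → G.vertexSet}

theorem eq_or_eq_of_isLink_side (hl : ∀ i, G.IsLink (side i) (p i) (p (finRotate v i)))
    {i : Fin v} {x y : G.vertexSet} (h : G.IsLink (side i) x y) :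
    (x = p i ∧ y = p (finRotate v i)) ∨ (x = p (finRotate v i) ∧ y = p i) := by
  rcases h.eq_and_eq_or_eq_and_eq (hl i) with ⟨h1, h2⟩ | ⟨h1, h2⟩
  · exact Or.inl ⟨Subtype.ext h1, Subtype.ext h2⟩
  · exact Or.inr ⟨Subtype.ext h1, Subtype.ext h2⟩

/-- The only sides at the vertex `p l` are the sides `l - 1` and `l`. -/
theorem ne_of_isLink_side (hl : ∀ i, G.IsLink (side i) (p i) (p (finRotate v i)))
    (hp : Function.Injective p) {l : Fin v} (h0 : (l : ℕ) ≠ 0) {i : Fin v} (hi : i ≠ l)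
    (hi' : (i : ℕ) + 1 ≠ l) {x y : G.vertexSet} (h : G.IsLink (side i) x y) : x ≠ p l := by
  rintro rfl
  rcases eq_or_eq_of_isLink_side hl h with ⟨h1, _⟩ | ⟨h1, _⟩
  · exact hi (hp h1).symm
  · have h2 := congrArg Fin.val (hp h1)
    rw [val_finRotate] at h2
    split_ifs at h2 <;> omega

variable {A : Type*} [CommRing A] [Finite G.vertexSet]

/-- With side `j` missing, the remaining sides form a path, whose cohomology sits in the lowest
height `j`. In the decreasing induction each side `l` is pendant at `p l`, since side `l - 1` is
absent. -/
theorem relVanishes_path (hs : Function.Injective side) (hp : Function.Injective p)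
    (hl : ∀ i, G.IsLink (side i) (p i) (p (finRotate v i))) {j k : ℕ} (hj : j ≤ v) (hk : j < k)
    {l : ℕ} (hjl : j < l) (hlv : l ≤ v) :
    RelVanishes G A (sidesBefore side j) (sidesFrom side l) k := by
  induction hlv using Nat.decreasingInduction with
  | self =>
    have : sidesFrom side v = ∅ := by
      rw [sidesFrom, Finset.image_eq_empty, Finset.filter_eq_empty_iff]
      intro i _
      exact not_le.2 i.2
    rw [this]
    exact relVanishes_empty (by rwa [card_sidesBefore hs hj])
  | of_succ l hlv ih =>
    have hlv : l < v := hlv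
    rw [show l = ((⟨l, hlv⟩ : Fin v) : ℕ) from rfl, ← insert_sidesFrom]
    refine relVanishes_insert_of_pendant (a := p (finRotate v ⟨l, hlv⟩)) (b := p ⟨l, hlv⟩) ?_
      (hl _).symm ?_ (ih (by omega))
    · rw [mem_sidesBefore hs]
      exact not_lt.2 hjl.le
    · intro w hw
      have h1 := (iff_of_comp_eq (fun w => w = p ⟨l, hlv⟩) ?_ hw).2 rfl
      · rw [h1]
      · intro x y e he hxy hx
        refine absurd hx ?_
        rcases Finset.mem_union.1 he with he | he
        · obtain ⟨i, hi, rfl⟩ := exists_of_mem_sidesBefore he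
          refine ne_of_isLink_side hl hp ?_ ?_ ?_ hxy
          · change l ≠ 0; omega
          · intro h; rw [h] at hi; change l < j at hi; omega
          · change (i : ℕ) + 1 ≠ l; omega
        · obtain ⟨i, hi, rfl⟩ := exists_of_mem_sidesFrom he
          refine ne_of_isLink_side hl hp ?_ ?_ ?_ hxy
          · change l ≠ 0; omega
          · intro h; rw [h] at hi; change l + 1 ≤ l at hi; omega
          · change (i : ℕ) + 1 ≠ l; change l + 1 ≤ i at hi; omega

/-- Contracting side `j` is harmless because its deletion, a path, has no cohomology in heights `v -
3` and `v - 2`. This needs `j < v - 3`, so the process stops with three sides left. -/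
theorem gradedIso_contract_sides (hs : Function.Injective side) (hp : Function.Injective p)
    (hl : ∀ i, G.IsLink (side i) (p i) (p (finRotate v i))) (𝒜 : ℕ → Submodule ℤ A)
    [GradedAlgebra 𝒜] {j : ℕ} (hj : j + 3 ≤ v) :
    GradedIso (relHDeg G 𝒜 (sidesBefore side j) (sidesFrom side j) (v - 2))
      (relHDeg G 𝒜 ∅ (sidesFrom side 0) (v - 2)) := by
  induction j with
  | zero =>
    have : sidesBefore side 0 = ∅ := by simp [sidesBefore]
    rw [this]
    exact GradedIso.refl _
  | succ j ih =>
    refine GradedIso.trans ?_ (ih (by omega))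
    have hjv : j < v := by omega
    have h1 := insert_sidesFrom (side := side) ⟨j, hjv⟩
    have h2 := insert_sidesBefore (side := side) ⟨j, hjv⟩
    dsimp only at h1 h2
    rw [← h1, ← h2, show v - 2 = v - 3 + 1 by omega]
    refine gradedIso_contract 𝒜 ?_ ?_ (relVanishes_path hs hp hl ?_ ?_ ?_ ?_)
      (relVanishes_path hs hp hl ?_ ?_ ?_ ?_)
    · rw [mem_sidesBefore hs]; exact lt_irrefl _
    · rw [mem_sidesFrom hs]; exact Nat.not_succ_le_self _
    all_goals omega

/-- The cohomology of a graph with a diagonal contracted vanishes in the last two degrees. -/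
theorem relVanishes_contract_diagonal (hp : Function.Bijective p)
    (hl : ∀ i, G.IsLink (side i) (p i) (p (finRotate v i))) {e : β} {a b : Fin v} (hab : a < b)
    (he : G.IsLink e (p a) (p b)) {E : Finset β} (heE : e ∉ E) (hE : ∀ i, side i ∈ E)
    (hcross : ∀ f ∈ E, f ∉ Set.range side → ∀ c d, G.IsLink f (p c) (p d) →
      ¬ (a < c ∧ c < b ∧ b < d) ∧ ¬ (c < a ∧ a < d ∧ d < b)) {k : ℕ} (hk : v ≤ k + 2) :
    RelVanishes G A (insert e ∅) E k := by
  classical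
  have hcomp : comp G (insert e (∅ : Finset β)) (p a) = comp G (insert e ∅) (p b) :=
    comp_eq_of_isLink (Finset.mem_insert_self e ∅) he
  -- An edge parallel to `e` becomes a loop. Otherwise both arcs between `a` and `b` carry an edge,
  -- and the cut vertex argument applies.
  by_cases hpar : ∃ f ∈ E, G.IsLink f (p a) (p b)
  · obtain ⟨f, hf, hlf⟩ := hpar
    refine relVanishes_of_loop (e := f) ?_ hf ?_
    · rintro hfe
      obtain rfl : f = e := by simpa using hfe
      exact heE hf
    · intro x y hxy
      rcases hxy.eq_and_eq_or_eq_and_eq hlf with ⟨h1, h2⟩ | ⟨h1, h2⟩ <;>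
        rw [Subtype.coe_inj] at h1 h2 <;> rw [h1, h2]
      · exact hcomp
      · exact hcomp.symm
  push Not at hpar
  set S₁ : Set G.vertexSet := {x | ∃ i, a ≤ i ∧ i ≤ b ∧ x = p i} with hS₁
  set S₂ : Set G.vertexSet := {x | ∃ i, (i ≤ a ∨ b ≤ i) ∧ x = p i} with hS₂
  have hmem₁ : ∀ i, p i ∈ S₁ ↔ a ≤ i ∧ i ≤ b := fun i =>
    ⟨fun ⟨j, h1, h2, h3⟩ => by rw [hp.1 h3]; exact ⟨h1, h2⟩, fun h => ⟨i, h.1, h.2, rfl⟩⟩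
  have hmem₂ : ∀ i, p i ∈ S₂ ↔ i ≤ a ∨ b ≤ i := fun i =>
    ⟨fun ⟨j, h1, h3⟩ => by rw [hp.1 h3]; exact h1, fun h => ⟨i, h, rfl⟩⟩
  have hrot : ∀ i : Fin v, ((finRotate v i : Fin v) : ℕ) =
      if (i : ℕ) + 1 = v then 0 else (i : ℕ) + 1 :=
    val_finRotate
  set E₁ := E.filter fun f => ∀ x y : G.vertexSet, G.IsLink f x y → x ∈ S₁ with hE₁
  set E₂ := E.filter fun f => ¬ ∀ x y : G.vertexSet, G.IsLink f x y → x ∈ S₁ with hE₂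
  have hunion : E₁ ∪ E₂ = E := Finset.filter_union_filter_not_eq _ E
  rw [← hunion]
  -- This is where non-crossing enters: an edge leaving the arc from `a` to `b` cannot end in its
  -- interior. A side cannot either, since it joins neighbours.
  have hother : ∀ f ∈ E, ∀ c d : Fin v, G.IsLink f (p c) (p d) → p c ∉ S₁ → p d ∈ S₂ := by
    intro f hf c d hcd hc
    rw [hmem₁] at hc
    rw [hmem₂]
    by_cases hside : f ∈ Set.range side
    · obtain ⟨i, rfl⟩ := hside
      have hri := hrot i
      rcases eq_or_eq_of_isLink_side hl hcd with ⟨h1, h2⟩ | ⟨h1, h2⟩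
      · obtain rfl := hp.1 h1
        obtain rfl := hp.1 h2
        simp only [Fin.le_def] at hc ⊢
        split_ifs at hri <;> omega
      · obtain rfl := hp.1 h1
        obtain rfl := hp.1 h2
        simp only [Fin.le_def] at hc ⊢
        have := d.2
        have := b.2
        split_ifs at hri <;> omega
    · have h1 := hcross f hf hside c d hcd
      have h2 := hcross f hf hside d c hcd.symm
      simp only [Fin.le_def, Fin.lt_def] at hc h1 h2 ⊢
      omega
  have hlink₂ : ∀ f ∈ E₂, ∀ x y : G.vertexSet, G.IsLink f x y → x ∈ S₂ := by
    intro f hf x y hxy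
    rw [hE₂, Finset.mem_filter] at hf
    obtain ⟨hfE, hf⟩ := hf
    push Not at hf
    obtain ⟨x', y', hxy', hx'⟩ := hf
    obtain ⟨c, rfl⟩ := hp.2 x'
    obtain ⟨d, rfl⟩ := hp.2 y'
    rcases hxy.eq_and_eq_or_eq_and_eq hxy' with ⟨h1, h2⟩ | ⟨h1, h2⟩ <;>
      rw [Subtype.coe_inj] at h1 h2 <;> subst h1 h2
    · rw [hmem₁] at hx'
      rw [hmem₂]
      simp only [Fin.le_def] at hx' ⊢
      omega
    · exact hother f hfE c d hxy' hx'
  have ha := a.2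
  have hb := b.2
  have hab' : (a : ℕ) < b := hab
  have hne₁ : E₁.Nonempty := by
    refine ⟨side a, Finset.mem_filter.2 ⟨hE a, fun x y hxy => ?_⟩⟩
    have hra := hrot a
    rcases eq_or_eq_of_isLink_side hl hxy with ⟨rfl, _⟩ | ⟨rfl, _⟩ <;> rw [hmem₁] <;>
      simp only [Fin.le_def] <;> split_ifs at hra <;> omega
  -- Side `b` leaves the arc unless `b` is the last vertex and `a` the first; then it would be
  -- parallel to `e`, against `hpar`.
  have hne₂ : E₂.Nonempty := by
    refine ⟨side b, Finset.mem_filter.2 ⟨hE b, fun h => ?_⟩⟩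
    have h1 := h _ _ (hl b).symm
    have hrb := hrot b
    rw [hmem₁, Fin.le_def, Fin.le_def] at h1
    split_ifs at hrb with hbv
    · have ha0 : finRotate v b = a := Fin.ext (by omega)
      have h2 := hl b
      rw [ha0] at h2
      exact hpar _ (hE b) h2.symm
    · omega
  have hcard : Nat.card (Comp G (insert e (∅ : Finset β))) < v := by
    refine (card_comp_lt (s := (∅ : Finset β)) (Finset.empty_subset _)
      (fun h => hab.ne (hp.1 (comp_empty_injective G h))) hcomp).trans_le ?_
    have : Function.Surjective fun i => comp G (∅ : Finset β) (p i) := by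
      intro c
      obtain ⟨x, rfl⟩ := exists_comp_eq c
      obtain ⟨i, rfl⟩ := hp.2 x
      exact ⟨i, rfl⟩
    simpa using Nat.card_le_card_of_surjective _ this
  have hpos : 0 < Nat.card (Comp G (insert e ∅ ∪ (E₁ ∪ E₂))) := by
    have : Nonempty (Comp G (insert e ∅ ∪ (E₁ ∪ E₂))) := ⟨comp G _ (p a)⟩
    exact Nat.card_pos
  refine relVanishes_of_cut (S₁ := S₁) (S₂ := S₂) (p := p a) hne₂ hlink₂ hne₁ ?_ ?_ ?_ ?_ ?_
  · exact fun f hf => (Finset.mem_filter.1 hf).2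
  · rintro x ⟨i, hi1, hi2, rfl⟩ y ⟨j, hj, rfl⟩ hxy
    rcases comp_insert_eq he hxy with h | ⟨h1, _⟩ | ⟨h1, _⟩
    · obtain rfl := hp.1 (comp_empty_injective G h)
      rcases hj with hj | hj
      · rw [le_antisymm hj hi1]
      · rw [le_antisymm hi2 hj, hcomp]
    · rw [comp_empty_injective G h1]
    · rw [comp_empty_injective G h1, hcomp]
  · exact Finset.disjoint_filter_filter_not E E _
  · rw [hunion]; simpa using heE
  · have : (insert e (∅ : Finset β)).card = 1 := by simp
    omega

theorem gradedIso_delete_diagonals (hs : Function.Injective side) (hp : Function.Bijective p)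
    (hl : ∀ i, G.IsLink (side i) (p i) (p (finRotate v i))) (hv : 2 ≤ v)
    (hloop : ∀ e ∉ Set.range side, ∀ x, ¬ G.IsLoopAt e x)
    (hcross : ∀ e ∉ Set.range side, ∀ e' ∉ Set.range side, ∀ a b c d : Fin v,
      G.IsLink e (p a) (p b) → G.IsLink e' (p c) (p d) → ¬ (a < c ∧ c < b ∧ b < d))
    (𝒜 : ℕ → Submodule ℤ A) [GradedAlgebra 𝒜] (F : Finset β) (hF : (F : Set β) ⊆ G.edgeSet)
    (hFs : ∀ e ∈ F, e ∉ Set.range side) :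
    GradedIso (relHDeg G 𝒜 ∅ (F ∪ sidesFrom side 0) (v - 2))
      (relHDeg G 𝒜 ∅ (sidesFrom side 0) (v - 2)) := by
  induction F using Finset.induction_on with
  | empty => rw [Finset.empty_union]; exact GradedIso.refl _
  | insert e F heF ih =>
    refine GradedIso.trans ?_ (ih (fun x hx => hF (Finset.mem_coe.2 (Finset.mem_insert_of_mem hx)))
      fun x hx => hFs x (Finset.mem_insert_of_mem hx))
    have hes := hFs e (Finset.mem_insert_self e F)
    have heE : e ∉ F ∪ sidesFrom side 0 := by
      rw [Finset.mem_union, not_or]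
      refine ⟨heF, fun h => ?_⟩
      obtain ⟨i, _, rfl⟩ := exists_of_mem_sidesFrom h
      exact hes ⟨i, rfl⟩
    obtain ⟨a, b, hab, hlink⟩ : ∃ a b, a < b ∧ G.IsLink e (p a) (p b) := by
      obtain ⟨x, y, hxy⟩ := (G.edge_mem_iff_exists_isLink e).1 (hF (by simp))
      obtain ⟨a, ha⟩ := hp.2 ⟨x, hxy.left_mem⟩
      obtain ⟨b, hb⟩ := hp.2 ⟨y, hxy.right_mem⟩
      have hlink : G.IsLink e (p a) (p b) := by rw [ha, hb]; exact hxy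
      rcases lt_trichotomy a b with h | h | h
      · exact ⟨a, b, h, hlink⟩
      · subst h; exact absurd hlink (hloop e hes _)
      · exact ⟨b, a, h, hlink.symm⟩
    have key : ∀ k, v ≤ k + 2 → RelVanishes G A (insert e ∅) (F ∪ sidesFrom side 0) k := fun k =>
      relVanishes_contract_diagonal hp hl hab hlink heE
        (fun i => Finset.mem_union_right _ ((mem_sidesFrom hs).2 (Nat.zero_le _)))
        fun f hf hfs c d hcd => ⟨hcross e hes f hfs a b c d hlink hcd,
          hcross f hfs e hes c d a b hcd hlink⟩
    rw [Finset.insert_union]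
    exact gradedIso_delete 𝒜 (Finset.notMem_empty e) heE (key _ (by omega)) (key _ (by omega))

/-- Reordering the edges of a contracted triangle. -/
theorem IsContractedPolygon.exists_strictMono {u : Finset β} {q : Fin 3 → G.vertexSet}
    {f : Fin 3 → β} (h : IsContractedPolygon G u q f) (hf : Function.Injective f) :
    ∃ (q' : Fin 3 → G.vertexSet) (f' : Fin 3 → β), IsContractedPolygon G u q' f' ∧
      StrictMono f' ∧ Finset.univ.image f' = Finset.univ.image f := by
  -- Special to the triangle: every permutation of its edges is induced by a permutation of its
  -- vertices, up to reversing edges. So the edges can be listed increasingly.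
  have key : ∀ σ : Equiv.Perm (Fin 3), ∃ τ : Equiv.Perm (Fin 3), ∀ i,
      (τ i = σ i ∧ τ (finRotate 3 i) = finRotate 3 (σ i)) ∨
        (τ i = finRotate 3 (σ i) ∧ τ (finRotate 3 i) = σ i) := by decide
  obtain ⟨τ, hτ⟩ := key (Tuple.sort f)
  refine ⟨q ∘ τ, f ∘ Tuple.sort f, ⟨fun i => h.notMem _, fun i => ?_, ?_, fun w => ?_⟩, ?_, ?_⟩
  · obtain ⟨x, y, hl, hx, hy⟩ := h.isLink (Tuple.sort f i)
    rcases hτ i with ⟨h1, h2⟩ | ⟨h1, h2⟩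
    · exact ⟨x, y, hl, by rw [Function.comp_apply, h1, hx], by rw [Function.comp_apply, h2, hy]⟩
    · exact ⟨y, x, hl.symm, by rw [Function.comp_apply, h1, hy],
        by rw [Function.comp_apply, h2, hx]⟩
  · exact h.injective.comp τ.injective
  · obtain ⟨i, hi⟩ := h.surjective w
    exact ⟨τ.symm i, by rw [Function.comp_apply, Equiv.apply_symm_apply, hi]⟩
  · exact (Tuple.monotone_sort f).strictMono_of_injective (hf.comp (Equiv.injective _))
  · rw [← Finset.image_image, Finset.image_univ_equiv]

/-- The triangle that is left of a polygon after contraction of all but three sides. -/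
theorem isContractedPolygon_sides (hs : Function.Injective side) (hp : Function.Bijective p)
    (hl : ∀ i, G.IsLink (side i) (p i) (p (finRotate v i))) {j : ℕ} (hj : j + 3 = v) :
    ∃ (q : Fin 3 → G.vertexSet) (f : Fin 3 → β), IsContractedPolygon G (sidesBefore side j) q f ∧
      Function.Injective f ∧ Finset.univ.image f = sidesFrom side j := by
  subst hj
  set u := sidesBefore side j with hu
  -- The vertices `0, …, j` are contracted to one point; by `hsep` the last two vertices stay
  -- isolated. These are the three vertices of the triangle.
  have hlow : ∀ i : Fin (j + 3), (i : ℕ) ≤ j →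
      comp G u (p i) = comp G u (p ⟨j, by omega⟩) := by
    intro ⟨i, hiv⟩ hi
    change i ≤ j at hi
    induction hi using Nat.decreasingInduction with
    | self => rfl
    | of_succ i hi ih =>
      rw [← ih (by omega)]
      have h1 := hl ⟨i, hiv⟩
      have h2 : finRotate (j + 3) ⟨i, hiv⟩ = ⟨i + 1, by omega⟩ := by
        apply Fin.ext
        rw [val_finRotate]
        exact if_neg (by change i + 1 ≠ j + 3; omega)
      rw [h2] at h1
      exact comp_eq_of_isLink ((mem_sidesBefore hs).2 hi) h1
  have hsep : ∀ i : Fin (j + 3), j < i → ∀ w, comp G u w = comp G u (p i) → w = p i := by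
    intro i hi w hw
    refine (iff_of_comp_eq (fun w => w = p i) ?_ hw).2 rfl
    intro x y e he hxy hx
    obtain ⟨l, hlj, rfl⟩ := exists_of_mem_sidesBefore he
    refine absurd hx (ne_of_isLink_side hl hp.1 (by omega) ?_ (by omega) hxy)
    rintro rfl
    omega
  have hadd : ∀ i : Fin 3, ((Fin.natAdd j i : Fin (j + 3)) : ℕ) = j + i := fun i => rfl
  refine ⟨fun i => p (Fin.natAdd j i), fun i => side (Fin.natAdd j i), ⟨fun i => ?_, fun i => ?_,
    ?_, fun w => ?_⟩, ?_, ?_⟩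
  · rw [hu, mem_sidesBefore hs, hadd]; omega
  · refine ⟨_, _, hl _, rfl, ?_⟩
    have h1 := val_finRotate (Fin.natAdd j i)
    have h2 := val_finRotate i
    rw [hadd] at h1
    by_cases hi : (i : ℕ) + 1 = 3
    · rw [if_pos (by omega)] at h1
      rw [if_pos hi] at h2
      rw [hlow _ (by omega), hlow (Fin.natAdd j (finRotate 3 i)) (by rw [hadd]; omega)]
    · rw [if_neg (by omega)] at h1
      rw [if_neg hi] at h2
      congr 2
      apply Fin.ext
      rw [h1, hadd, h2]
      omega
  · intro i i' hii
    have h3 : (i : ℕ) = i' := by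
      rcases Nat.eq_zero_or_pos (i : ℕ) with h0 | h0
      · rcases Nat.eq_zero_or_pos (i' : ℕ) with h0' | h0'
        · omega
        · have := congrArg Fin.val (hp.1 (hsep _ (by rw [hadd]; omega) _ hii))
          simp only [hadd] at this; omega
      · have := congrArg Fin.val (hp.1 (hsep _ (by rw [hadd]; omega) _ hii.symm))
        simp only [hadd] at this; omega
    exact Fin.ext h3
  · obtain ⟨i, rfl⟩ := hp.2 w
    by_cases hi : (i : ℕ) ≤ j
    · exact ⟨0, hlow i hi⟩
    · refine ⟨⟨i - j, by omega⟩, ?_⟩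
      congr 2
      apply Fin.ext
      rw [hadd]
      change (i : ℕ) = j + (i - j)
      omega
  · exact hs.comp (Fin.natAdd_injective 3 j)
  · ext e
    simp only [Finset.mem_image, Finset.mem_univ, true_and]
    constructor
    · rintro ⟨i, rfl⟩
      rw [mem_sidesFrom hs, hadd]; omega
    · intro he
      obtain ⟨i, hi, rfl⟩ := exists_of_mem_sidesFrom he
      refine ⟨⟨i - j, by omega⟩, ?_⟩
      congr 1
      apply Fin.ext
      rw [hadd]
      change j + ((i : ℕ) - j) = i
      omega

/-- Height `v - 2` is kept throughout. Of it, `v - 3` is used by the contracted sides, which leaves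
height `1` on the triangle. -/
theorem gradedIso_of_isPolygonWithDiagonals [Finite G.edgeSet] (hv : 3 ≤ v)
    (hG : IsPolygonWithDiagonals G v) (𝒜 : ℕ → Submodule ℤ A) [GradedAlgebra 𝒜] :
    GradedIso (HDeg G 𝒜 (v - 2)) (HDeg (polygon 3) 𝒜 1) := by
  classical
  obtain ⟨p', side, hp', hrange, hs, hl, hloop, hcross⟩ := hG
  let p : Fin v → G.vertexSet := fun i => ⟨p' i, hrange ▸ Set.mem_range_self i⟩
  have hp : Function.Bijective p := by
    refine ⟨fun i j h => hp' (congrArg Subtype.val h), fun ⟨x, hx⟩ => ?_⟩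
    rw [← hrange] at hx
    obtain ⟨i, rfl⟩ := hx
    exact ⟨i, rfl⟩
  have hl' : ∀ i, G.IsLink (side i) (p i) (p (finRotate v i)) := hl
  set E := G.edgeSet.toFinite.toFinset with hE
  have hEe : ((E.filter (· ∉ Set.range side) ∪ sidesFrom side 0 : Finset β) : Set β) =
      G.edgeSet := by
    ext e
    simp only [Finset.mem_coe, Finset.mem_union, Finset.mem_filter, hE, Set.Finite.mem_toFinset]
    constructor
    · rintro (h | h)
      · exact h.1
      · obtain ⟨i, _, rfl⟩ := exists_of_mem_sidesFrom h
        exact (hl i).edge_mem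
    · intro he
      by_cases hes : e ∈ Set.range side
      · obtain ⟨i, rfl⟩ := hes
        exact Or.inr ((mem_sidesFrom hs).2 (Nat.zero_le _))
      · exact Or.inl ⟨he, hes⟩
  have h1 := gradedIso_HDeg 𝒜 hEe (v - 2)
  have h2 := gradedIso_delete_diagonals hs hp hl' (by omega) hloop hcross 𝒜
    (E.filter (· ∉ Set.range side)) (fun e he => by
      rw [Finset.mem_coe, Finset.mem_filter, hE, Set.Finite.mem_toFinset] at he
      exact he.1) (fun e he => (Finset.mem_filter.1 he).2)
  have h3 := gradedIso_contract_sides hs hp.1 hl' 𝒜 (j := v - 3) (by omega)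
  obtain ⟨q, f, hqf, hf, him⟩ := isContractedPolygon_sides hs hp hl' (j := v - 3) (by omega)
  obtain ⟨q', f', hqf', hf', him'⟩ := hqf.exists_strictMono hf
  have h4 := gradedIso_polygon hqf' hf' 𝒜 1
  rw [him', him, card_sidesBefore hs (by omega), show v - 3 + 1 = v - 2 by omega] at h4
  have h5 := gradedIso_HDeg (G := polygon 3) 𝒜 (E := Finset.univ) Finset.coe_univ 1
  exact (h1.symm.trans h2).trans ((h3.symm.trans h4.symm).trans h5)

end PolygonWithDiagonals

theorem GradedIso.nonempty_equiv {M N : Type*} [AddCommGroup M] [AddCommGroup N]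
    {p : ℕ → Submodule ℤ M} {q : ℕ → Submodule ℤ N} (h : GradedIso p q) (j : ℕ) :
    Nonempty (p j ≃ₗ[ℤ] q j) := by
  obtain ⟨φ, hφ⟩ := h
  exact ⟨(φ.submoduleMap (p j)).trans (LinearEquiv.ofEq _ _ (hφ j))⟩

/-! ### The algebra of truncated polynomials and its residue pairing. -/

section TruncPoly

variable {m : ℕ}

/-- The class of `x ^ n`. -/
def truncX (m n : ℕ) : TruncPoly m := Ideal.Quotient.mk _ (Polynomial.X ^ n)

theorem truncX_eq_pow (n : ℕ) :
    truncX m n = (Ideal.Quotient.mk _ Polynomial.X : TruncPoly m) ^ n := map_pow _ _ _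

theorem truncX_one_pow (n : ℕ) : truncX m 1 ^ n = truncX m n := by
  rw [truncX_eq_pow, truncX_eq_pow, pow_one]

theorem truncX_self : truncX m m = 0 :=
  Ideal.Quotient.eq_zero_iff_mem.2 (Ideal.mem_span_singleton_self _)

theorem truncX_add (a b : ℕ) : truncX m (a + b) = truncX m a * truncX m b := by
  rw [truncX, pow_add, map_mul]; rfl

theorem truncX_sum {ι : Type*} (s : Finset ι) (k : ι → ℕ) :
    truncX m (∑ i ∈ s, k i) = ∏ i ∈ s, truncX m (k i) := by
  rw [truncX, ← Finset.prod_pow_eq_pow_sum, map_prod]; rfl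

theorem truncX_mem (j : ℕ) : truncX m j ∈ truncPolyDeg m j := Submodule.mem_span_singleton_self _

theorem mem_truncPolyDeg {j : ℕ} {a : TruncPoly m} :
    a ∈ truncPolyDeg m j ↔ ∃ n : ℤ, n • truncX m j = a := Submodule.mem_span_singleton

instance truncPolyDeg_gradedMonoid : SetLike.GradedMonoid (truncPolyDeg m) where
  one_mem := truncX_mem 0
  mul_mem := by
    intro i j a b ha hb
    obtain ⟨k, rfl⟩ := mem_truncPolyDeg.1 ha
    obtain ⟨l, rfl⟩ := mem_truncPolyDeg.1 hb
    rw [smul_mul_smul_comm, ← truncX_add]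
    exact Submodule.smul_mem _ _ (truncX_mem _)

open DirectSum in
/-- The decomposition of `A_m` in homogeneous parts. -/
def truncPolyDecompose (m : ℕ) : TruncPoly m →ₐ[ℤ] ⨁ i, truncPolyDeg m i :=
  Ideal.Quotient.liftₐ _ (Polynomial.aeval (DirectSum.of (fun i => truncPolyDeg m i) 1
    ⟨truncX m 1, truncX_mem 1⟩)) <| by
    intro a ha
    obtain ⟨c, rfl⟩ := Ideal.mem_span_singleton.1 ha
    have h : GradedMonoid.GMonoid.gnpow (A := fun i => truncPolyDeg m i) m
        (⟨truncX m 1, truncX_mem 1⟩ : truncPolyDeg m 1) = 0 :=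
      Subtype.ext ((truncX_one_pow m).trans truncX_self)
    rw [map_mul, map_pow, Polynomial.aeval_X, DirectSum.ofPow, h, map_zero, zero_mul]

theorem truncPolyDecompose_X : truncPolyDecompose m (Ideal.Quotient.mk _ Polynomial.X) =
    DirectSum.of (fun i => truncPolyDeg m i) 1 ⟨truncX m 1, truncX_mem 1⟩ :=
  Polynomial.aeval_X _

instance truncPolyDeg_gradedAlgebra : GradedAlgebra (truncPolyDeg m) :=
  GradedAlgebra.ofAlgHom _ (truncPolyDecompose m)
    (by
      apply Ideal.Quotient.algHom_ext
      apply Polynomial.algHom_ext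
      change DirectSum.coeAlgHom (truncPolyDeg m) (truncPolyDecompose m (Ideal.Quotient.mk _
        Polynomial.X)) = Ideal.Quotient.mk _ Polynomial.X
      rw [truncPolyDecompose_X, DirectSum.coeAlgHom_of]
      exact (truncX_eq_pow 1).trans (pow_one _))
    (by
      rintro i ⟨a, ha⟩
      obtain ⟨n, rfl⟩ := mem_truncPolyDeg.1 ha
      rw [map_zsmul]
      have : truncPolyDecompose m (truncX m i) =
          DirectSum.of (fun i => truncPolyDeg m i) i ⟨truncX m i, truncX_mem i⟩ := by
        refine ((congrArg _ (truncX_eq_pow i)).trans (map_pow _ _ _)).trans ?_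
        rw [truncPolyDecompose_X, DirectSum.ofPow]
        exact DirectSum.of_eq_of_gradedMonoid_eq
          (Sigma.subtype_ext (Nat.mul_one i) (truncX_one_pow i))
      rw [this, ← map_zsmul]
      rfl)

/-- The coefficient of `x ^ (m - 1)` in `p * q'`, modulo `m`. -/
def residue (m : ℕ) (p q : Polynomial ℤ) : ZMod m :=
  (((p * Polynomial.derivative q).coeff (m - 1) : ℤ) : ZMod m)

theorem residue_add_left (p p' q : Polynomial ℤ) :
    residue m (p + p') q = residue m p q + residue m p' q := by simp [residue, add_mul]

theorem residue_add_right (p q q' : Polynomial ℤ) :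
    residue m p (q + q') = residue m p q + residue m p q' := by simp [residue, mul_add]

/-- A multiple of `X ^ m` on the left has no coefficient of degree `m - 1`. On the right, its
derivative contributes to that degree only with a factor `m`. -/
theorem residue_congr (hm : 1 ≤ m) {p p' q q' : Polynomial ℤ}
    (hp : (Ideal.Quotient.mk _ p : TruncPoly m) = Ideal.Quotient.mk _ p')
    (hq : (Ideal.Quotient.mk _ q : TruncPoly m) = Ideal.Quotient.mk _ q') :
    residue m p q = residue m p' q' := by
  rw [Ideal.Quotient.eq, Ideal.mem_span_singleton] at hp hq
  obtain ⟨c, hc⟩ := hp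
  obtain ⟨c', hc'⟩ := hq
  have h1 : ∀ c q : Polynomial ℤ, residue m (Polynomial.X ^ m * c) q = 0 := by
    intro c q
    rw [residue, mul_assoc, Polynomial.coeff_X_pow_mul', if_neg (by omega), Int.cast_zero]
  have h2 : ∀ p c : Polynomial ℤ, residue m p (Polynomial.X ^ m * c) = 0 := by
    intro p c
    rw [residue, Polynomial.derivative_mul, Polynomial.derivative_X_pow,
      show p * (Polynomial.C (m : ℤ) * Polynomial.X ^ (m - 1) * c +
        Polynomial.X ^ m * Polynomial.derivative c) =
        Polynomial.C (m : ℤ) * (Polynomial.X ^ (m - 1) * c * p) +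
          Polynomial.X ^ m * (Polynomial.derivative c * p) by ring,
      Polynomial.coeff_add, Polynomial.coeff_C_mul, Polynomial.coeff_X_pow_mul',
      if_neg (by omega), add_zero]
    simp
  rw [show p = p' + Polynomial.X ^ m * c by rw [← hc]; ring,
    show q = q' + Polynomial.X ^ m * c' by rw [← hc']; ring]
  rw [residue_add_left, h1, residue_add_right, h2, add_zero, add_zero]

/-- By Leibniz the sum is the coefficient of degree `m - 1` in the derivative of `p * q * r`, a
multiple of `m`. -/
theorem residue_cyclic (hm : 1 ≤ m) (p q r : Polynomial ℤ) :
    residue m (p * q) r + residue m (q * r) p + residue m (r * p) q = 0 := by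
  have h : p * q * Polynomial.derivative r + q * r * Polynomial.derivative p +
      r * p * Polynomial.derivative q = Polynomial.derivative (p * q * r) := by
    rw [Polynomial.derivative_mul, Polynomial.derivative_mul]; ring
  rw [residue, residue, residue, ← Int.cast_add, ← Int.cast_add, ← Polynomial.coeff_add,
    ← Polynomial.coeff_add, h, Polynomial.coeff_derivative, Int.cast_mul,
    show ((((m - 1 : ℕ) : ℤ) + 1 : ℤ) : ZMod m) = ((m : ℕ) : ZMod m) by
      rw [← Nat.cast_succ, Int.cast_natCast]; congr 1; omega, ZMod.natCast_self, mul_zero]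

theorem residue_X_pow {a b : ℕ} (h : a + b = m) :
    residue m (Polynomial.X ^ a) (Polynomial.X ^ b) = (b : ZMod m) := by
  rw [residue, Polynomial.derivative_X_pow, mul_left_comm, ← pow_add, Polynomial.coeff_C_mul,
    Polynomial.coeff_X_pow]
  rcases Nat.eq_zero_or_pos b with rfl | hb
  · simp
  · rw [if_pos (by omega)]; simp

/-- A representative. -/
def truncRep (a : TruncPoly m) : Polynomial ℤ := (Ideal.Quotient.mk_surjective a).choose

theorem mk_truncRep (a : TruncPoly m) : Ideal.Quotient.mk _ (truncRep a) = a :=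
  (Ideal.Quotient.mk_surjective a).choose_spec

/-- The coefficient of `x ^ (m - 1)` in `a * b'`, modulo `m`. -/
def truncResidue (hm : 1 ≤ m) : TruncPoly m →+ TruncPoly m →+ ZMod m :=
  AddMonoidHom.mk' (fun a => AddMonoidHom.mk' (fun b => residue m (truncRep a) (truncRep b))
    (fun b b' => by
      rw [← residue_add_right]
      exact residue_congr hm rfl (by simp only [map_add, mk_truncRep])))
    (fun a a' => by
      ext b
      change residue m _ _ = residue m _ _ + residue m _ _
      rw [← residue_add_left]
      exact residue_congr hm (by simp only [map_add, mk_truncRep]) rfl)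

theorem truncResidue_mk (hm : 1 ≤ m) (p q : Polynomial ℤ) :
    truncResidue hm (Ideal.Quotient.mk _ p) (Ideal.Quotient.mk _ q) = residue m p q :=
  residue_congr hm (mk_truncRep _) (mk_truncRep _)

theorem truncResidue_truncX (hm : 1 ≤ m) {a b : ℕ} (h : a + b = m) :
    truncResidue hm (truncX m a) (truncX m b) = (b : ZMod m) := by
  rw [truncX, truncX, truncResidue_mk, residue_X_pow h]

theorem truncResidue_cyclic (hm : 1 ≤ m) (a b c : TruncPoly m) :
    truncResidue hm (a * b) c + truncResidue hm (b * c) a + truncResidue hm (c * a) b = 0 := by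
  obtain ⟨p, rfl⟩ := Ideal.Quotient.mk_surjective a
  obtain ⟨q, rfl⟩ := Ideal.Quotient.mk_surjective b
  obtain ⟨r, rfl⟩ := Ideal.Quotient.mk_surjective c
  rw [← map_mul, ← map_mul, ← map_mul, truncResidue_mk, truncResidue_mk, truncResidue_mk,
    residue_cyclic hm]

end TruncPoly

/-! ### Components of spanning subgraphs of the triangle. -/

section Triangle

/-- A vertex of the triangle. -/
def triVertex (j : Fin 3) : (polygon 3).vertexSet := ⟨j, trivial⟩

theorem comp_triangle_rotate {s : Finset (Fin 3)} {i : Fin 3} (hi : i ∈ s) :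
    comp (polygon 3) s (triVertex i) = comp (polygon 3) s (triVertex (i + 1)) :=
  comp_eq_of_isLink hi (by change s(_, _) = s(_, _); rw [finRotate_apply]; rfl)

theorem exists_triVertex {s : Finset (Fin 3)} (c : Comp (polygon 3) s) :
    ∃ j, comp (polygon 3) s (triVertex j) = c := by
  obtain ⟨⟨j, _⟩, rfl⟩ := exists_comp_eq c
  exact ⟨j, rfl⟩

/-- Edge `i` joins `i` and `i + 1`, so `i + 2` is the isolated vertex. -/
theorem comp_singleton_iff {i j l : Fin 3} :
    comp (polygon 3) {i} (triVertex j) = comp (polygon 3) {i} (triVertex l) ↔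
      j = l ∨ (j ≠ i + 2 ∧ l ≠ i + 2) := by
  constructor
  · intro h
    refine (iff_of_comp_eq (fun x : (polygon 3).vertexSet =>
      j = x.1 ∨ (j ≠ i + 2 ∧ x.1 ≠ i + 2)) ?_ h).1 (Or.inl rfl)
    intro x y e he hl
    obtain rfl := Finset.mem_singleton.1 he
    have hl' : s(x.1, y.1) = s(e, finRotate 3 e) := hl
    have key : ∀ e x y j : Fin 3, s(x, y) = s(e, finRotate 3 e) →
        (j = x ∨ (j ≠ e + 2 ∧ x ≠ e + 2)) → (j = y ∨ (j ≠ e + 2 ∧ y ≠ e + 2)) := by decide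
    exact key e x.1 y.1 j hl'
  · rintro (rfl | ⟨h1, h2⟩)
    · rfl
    · have key : ∀ i j : Fin 3, j ≠ i + 2 → j = i ∨ j = i + 1 := by decide
      have h := comp_triangle_rotate (Finset.mem_singleton_self i)
      rcases key i j h1 with hj | hj <;> rcases key i l h2 with hl | hl <;> rw [hj, hl]
      · exact h
      · exact h.symm

/-- The component of the triangle with one edge `i` that has two vertices. -/
def pairComp (i : Fin 3) : Comp (polygon 3) {i} := comp (polygon 3) {i} (triVertex i)

/-- The component of the triangle with one edge `i` that has one vertex. -/
def singleComp (i : Fin 3) : Comp (polygon 3) {i} := comp (polygon 3) {i} (triVertex (i + 2))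

theorem pairComp_ne_singleComp (i : Fin 3) : pairComp i ≠ singleComp i := by
  rw [pairComp, singleComp, Ne, comp_singleton_iff]
  revert i; decide

theorem eq_pairComp_or {i : Fin 3} (c : Comp (polygon 3) {i}) :
    c = pairComp i ∨ c = singleComp i := by
  obtain ⟨j, rfl⟩ := exists_triVertex c
  rw [pairComp, singleComp, comp_singleton_iff, comp_singleton_iff]
  revert i j; decide

theorem univ_comp_singleton (i : Fin 3) :
    (Finset.univ : Finset (Comp (polygon 3) {i})) = {pairComp i, singleComp i} := by
  ext c
  simpa using eq_pairComp_or c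

theorem subsingleton_comp_of_card_eq_two {t : Finset (Fin 3)} (ht : t.card = 2) :
    Subsingleton (Comp (polygon 3) t) := by
  have key : ∀ t : Finset (Fin 3), t.card = 2 → ∃ i, i ∈ t ∧ i + 1 ∈ t := by decide
  obtain ⟨i, hi, hi'⟩ := key t ht
  have h : ∀ j, comp (polygon 3) t (triVertex j) = comp (polygon 3) t (triVertex i) := by
    intro j
    have h3 : ∀ i j : Fin 3, j = i ∨ j = i + 1 ∨ j = i + 1 + 1 := by decide
    rcases h3 i j with rfl | rfl | rfl
    · rfl
    · exact (comp_triangle_rotate hi).symm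
    · rw [← comp_triangle_rotate hi', ← comp_triangle_rotate hi]
  refine ⟨fun c c' => ?_⟩
  obtain ⟨j, rfl⟩ := exists_triVertex c
  obtain ⟨j', rfl⟩ := exists_triVertex c'
  rw [h j, h j']

/-- The vertices of the triangle are the components of the graph without edges. -/
def triVertexEquiv : Fin 3 ≃ Comp (polygon 3) (∅ : Finset (Fin 3)) :=
  Equiv.ofBijective (fun j => comp (polygon 3) ∅ (triVertex j))
    ⟨fun _ _ h => congrArg Subtype.val (comp_empty_injective _ h), exists_triVertex⟩

theorem triVertexEquiv_apply (j : Fin 3) :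
    triVertexEquiv j = comp (polygon 3) ∅ (triVertex j) := rfl

open Classical in
theorem prod_fiber_compMap {M : Type*} [CommMonoid M] (i : Fin 3)
    (a : Comp (polygon 3) (∅ : Finset (Fin 3)) → M) (l : Fin 3) :
    ∏ c with compMap (polygon 3) (Finset.empty_subset {i}) c =
        comp (polygon 3) {i} (triVertex l), a c =
      ∏ j, if j = l ∨ (j ≠ i + 2 ∧ l ≠ i + 2) then a (triVertexEquiv j) else 1 := by
  rw [Finset.prod_filter, ← Equiv.prod_comp triVertexEquiv]
  refine Finset.prod_congr rfl fun j _ => ?_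
  simp only [triVertexEquiv_apply, compMap_comp, comp_singleton_iff]

open Classical in
theorem prod_fiber_pairComp {M : Type*} [CommMonoid M] (i : Fin 3)
    (a : Comp (polygon 3) (∅ : Finset (Fin 3)) → M) :
    ∏ c with compMap (polygon 3) (Finset.empty_subset {i}) c = pairComp i, a c =
      a (triVertexEquiv i) * a (triVertexEquiv (i + 1)) := by
  rw [pairComp, prod_fiber_compMap]
  fin_cases i <;> simp [Fin.prod_univ_three, mul_comm]

open Classical in
theorem prod_fiber_singleComp {M : Type*} [CommMonoid M] (i : Fin 3)
    (a : Comp (polygon 3) (∅ : Finset (Fin 3)) → M) :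
    ∏ c with compMap (polygon 3) (Finset.empty_subset {i}) c = singleComp i, a c =
      a (triVertexEquiv (i + 2)) := by
  rw [singleComp, prod_fiber_compMap]
  fin_cases i <;> simp

end Triangle

/-- The relations among the classes of monomials in the triangle determine all of them. -/
theorem eq_nsmul_of_cyclic_relation {M : Type*} [AddCommGroup M] {m : ℕ} (U : Fin 3 → ℕ → M)
    (h0 : ∀ i, U i 0 = 0)
    (hU : ∀ a b c, a + b + c = m → U 0 c + U 1 a + U 2 b = 0) :
    ∀ i, ∀ n ≤ m, U i n = n • U 0 1 := by
  -- Triples with one zero exponent show that the three families agree and that `n ↦ m - n` reverses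
  -- the sign. The general triple then becomes additivity in `hadd`.
  have h1 : ∀ n ≤ m, U 0 n + U 1 (m - n) = 0 := fun n hn => by
    simpa [h0] using hU (m - n) 0 n (by omega)
  have h2 : ∀ n ≤ m, U 0 n + U 2 (m - n) = 0 := fun n hn => by
    simpa [h0] using hU 0 (m - n) n (by omega)
  have h3 : ∀ n ≤ m, U 1 n + U 2 (m - n) = 0 := fun n hn => by
    simpa [h0] using hU n (m - n) 0 (by omega)
  have h10 : ∀ n ≤ m, U 1 n = U 0 n := fun n hn =>
    add_right_cancel ((h3 n hn).trans (h2 n hn).symm)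
  have h20 : ∀ n ≤ m, U 2 n = U 0 n := fun n hn => by
    have h4 := h1 (m - n) (by omega)
    have h5 := h2 (m - n) (by omega)
    rw [Nat.sub_sub_self hn] at h4 h5
    rw [← h10 n hn]
    exact add_left_cancel (h5.trans h4.symm)
  have hadd : ∀ a b, a + b ≤ m → U 0 (a + b) = U 0 a + U 0 b := fun a b hab => by
    have h4 := hU a b (m - (a + b)) (by omega)
    have h5 := h1 (m - (a + b)) (by omega)
    rw [Nat.sub_sub_self hab, h10 _ hab] at h5
    rw [h10 a (by omega), h20 b (by omega), add_assoc] at h4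
    exact add_left_cancel (h5.trans h4.symm)
  have hmain : ∀ n ≤ m, U 0 n = n • U 0 1 := by
    intro n
    induction n with
    | zero => intro _; rw [h0, zero_smul]
    | succ n ih => intro hn; rw [hadd n 1 hn, ih (by omega), succ_nsmul]
  intro i n hn
  fin_cases i
  · exact hmain n hn
  · exact (h10 n hn).trans (hmain n hn)
  · exact (h20 n hn).trans (hmain n hn)

/-! ### Tensor products of powers of `x`. -/

section Monomials

variable {S T : Type*} {m : ℕ}

/-- The tensor product of powers of `x`. -/
def truncMonomial (m : ℕ) (k : S → ℕ) : ⨂[ℤ] _ : S, TruncPoly m :=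
  PiTensorProduct.tprod ℤ fun c => truncX m (k c)

theorem truncMonomial_eq_zero {k : S → ℕ} {c : S} (hc : k c = m) : truncMonomial m k = 0 :=
  MultilinearMap.map_coord_zero _ c (by rw [hc, truncX_self])

variable [Fintype S]

theorem truncMonomial_mem {k : S → ℕ} {j : ℕ} (hk : ∑ c, k c = j) :
    truncMonomial m k ∈ tensorDeg (truncPolyDeg m) S j :=
  Submodule.subset_span ⟨k, _, fun c => truncX_mem (k c), hk, rfl⟩

open Classical in
theorem tensorMap_truncMonomial (g : S → T) (k : S → ℕ) :
    tensorMap (TruncPoly m) g (truncMonomial m k) =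
      truncMonomial m fun t => ∑ c with g c = t, k c := by
  rw [truncMonomial, tensorMap_tprod, truncMonomial]
  simp only [truncX_sum]

theorem tensorDeg_truncPoly (j : ℕ) : tensorDeg (truncPolyDeg m) S j =
    Submodule.span ℤ {z | ∃ k : S → ℕ, ∑ c, k c = j ∧ truncMonomial m k = z} := by
  apply le_antisymm
  · refine Submodule.span_le.2 ?_
    rintro _ ⟨k, a, ha, hk, rfl⟩
    choose n hn using fun c => mem_truncPolyDeg.1 (ha c)
    obtain rfl : (fun c => n c • truncX m (k c)) = a := funext hn
    rw [MultilinearMap.map_smul_univ]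
    exact Submodule.smul_mem _ _ (Submodule.subset_span ⟨k, hk, rfl⟩)
  · refine Submodule.span_le.2 ?_
    rintro _ ⟨k, hk, rfl⟩
    exact truncMonomial_mem hk

/-- With a single tensor factor, degree `m` means a multiple of `x ^ m`, which is zero. -/
theorem eq_zero_of_mem_tensorDeg [Subsingleton S] [Nonempty S] {z : ⨂[ℤ] _ : S, TruncPoly m}
    (hz : z ∈ tensorDeg (truncPolyDeg m) S m) : z = 0 := by
  rw [tensorDeg_truncPoly] at hz
  induction hz using Submodule.span_induction with
  | zero => rfl
  | add x y _ _ hx hy => rw [hx, hy, add_zero]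
  | smul n x _ hx => rw [hx, smul_zero]
  | mem z hz =>
    obtain ⟨k, hk, rfl⟩ := hz
    obtain ⟨c⟩ := ‹Nonempty S›
    exact truncMonomial_eq_zero (c := c) (by rw [← hk, Fintype.sum_subsingleton _ c])

end Monomials

/-! ### Degree `m` cohomology of the triangle. -/

section TriangleCohomology

variable {m : ℕ}

/-- No edge of a singleton precedes its element, so all signs into height one are positive. -/
theorem relD_triangle_singleton {A : Type*} [CommRing A] (y : Labels (polygon 3) A) (i : Fin 3) :
    relD (polygon 3) A ∅ y {i} = merge (polygon 3) A (Finset.empty_subset {i}) (y ∅) := by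
  rw [relD_apply, Finset.sdiff_empty, Finset.sum_singleton,
    merge_congr y (show ({i} : Finset (Fin 3)).erase i = ∅ by simp) _ (Finset.empty_subset {i})]
  have : ({i} : Finset (Fin 3)).filter (· < i) = ∅ := by simp [Finset.filter_singleton]
  rw [edgeSign, this, Finset.card_empty, pow_zero, one_smul]

theorem mem_relCoboundaries_triangle {A : Type*} [CommRing A] {x : Labels (polygon 3) A} :
    x ∈ relCoboundaries (polygon 3) A ∅ Finset.univ 1 ↔
      ∃ z, ∀ i, merge (polygon 3) A (Finset.empty_subset {i}) z = x {i} := by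
  constructor
  · rintro ⟨y, hy⟩
    refine ⟨y ∅, fun i => ?_⟩
    rw [← relD_triangle_singleton]
    exact hy {i} (Finset.empty_subset _) (by simp) rfl
  · rintro ⟨z, hz⟩
    refine ⟨Function.update 0 ∅ z, fun t _ _ ht => ?_⟩
    obtain ⟨i, rfl⟩ := Finset.card_eq_one.1 ht
    rw [relD_triangle_singleton, Function.update_self, hz]

/-- Two edges connect the triangle, so the differential lands in the degree `m` part of one copy of
the algebra, which is zero. -/
theorem mem_relCocycles_triangle {x : Labels (polygon 3) (TruncPoly m)}
    (hx : x ∈ labelsDeg (polygon 3) (truncPolyDeg m) m) :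
    x ∈ relCocycles (polygon 3) (TruncPoly m) ∅ Finset.univ 1 := by
  intro t _ _ ht
  have := subsingleton_comp_of_card_eq_two ht
  have : Nonempty (Comp (polygon 3) t) := ⟨comp _ _ (triVertex 0)⟩
  refine eq_zero_of_mem_tensorDeg ?_
  rw [relD_apply]
  refine Submodule.sum_mem _ fun e _ => Submodule.smul_mem _ _ ?_
  rw [merge_eq_tensorMap]
  exact tensorMap_mem_tensorDeg _ _ (hx _ trivial)

/-- The exponents of `x ^ (m - n) ⊗ x ^ n`. -/
def triExponents (m : ℕ) (i : Fin 3) (n : ℕ) (c : Comp (polygon 3) {i}) : ℕ :=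
  if c = singleComp i then n else m - n

theorem triExponents_singleComp (i : Fin 3) (n : ℕ) :
    triExponents m i n (singleComp i) = n := if_pos rfl

theorem triExponents_pairComp (i : Fin 3) (n : ℕ) :
    triExponents m i n (pairComp i) = m - n := if_neg (pairComp_ne_singleComp i)

theorem sum_comp_singleton {M : Type*} [AddCommMonoid M] {i : Fin 3}
    (k : Comp (polygon 3) {i} → M) : ∑ c, k c = k (pairComp i) + k (singleComp i) := by
  rw [univ_comp_singleton, Finset.sum_pair (pairComp_ne_singleComp i)]

theorem eq_triExponents {i : Fin 3} {k : Comp (polygon 3) {i} → ℕ}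
    (hk : k (pairComp i) + k (singleComp i) = m) : k = triExponents m i (k (singleComp i)) := by
  funext c
  rcases eq_pairComp_or c with rfl | rfl
  · rw [triExponents_pairComp]; omega
  · rw [triExponents_singleComp]

/-- The monomial `x ^ (m - n) ⊗ x ^ n` at the edge `i` of the triangle. -/
def triMonomial (m : ℕ) (i : Fin 3) (n : ℕ) : State (polygon 3) (TruncPoly m) {i} :=
  truncMonomial m (triExponents m i n)

theorem triMonomial_mem {i : Fin 3} {n : ℕ} (hn : n ≤ m) :
    triMonomial m i n ∈ stateDeg (polygon 3) (truncPolyDeg m) {i} m := by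
  refine truncMonomial_mem ?_
  rw [sum_comp_singleton, triExponents_pairComp, triExponents_singleComp]
  omega

theorem triMonomial_zero (i : Fin 3) : triMonomial m i 0 = 0 :=
  truncMonomial_eq_zero (c := pairComp i) (by rw [triExponents_pairComp]; rfl)

theorem triMonomial_self (i : Fin 3) : triMonomial m i m = 0 :=
  truncMonomial_eq_zero (c := singleComp i) (triExponents_singleComp i m)

theorem merge_truncMonomial {k : Comp (polygon 3) (∅ : Finset (Fin 3)) → ℕ} {i : Fin 3}
    (hk : k (triVertexEquiv i) + k (triVertexEquiv (i + 1)) + k (triVertexEquiv (i + 2)) = m) :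
    merge (polygon 3) (TruncPoly m) (Finset.empty_subset {i}) (truncMonomial m k) =
      triMonomial m i (k (triVertexEquiv (i + 2))) := by
  classical
  -- The exponents add over fibres; `Multiplicative ℕ` turns the product formulas into these sums.
  have h1 := prod_fiber_pairComp (M := Multiplicative ℕ) i k
  have h2 := prod_fiber_singleComp (M := Multiplicative ℕ) i k
  rw [merge_eq_tensorMap, tensorMap_truncMonomial, triMonomial]
  rw [eq_triExponents (m := m)
    (k := fun t => ∑ c with compMap (polygon 3) (Finset.empty_subset {i}) c = t, k c)]
  · congr 2
  · refine Eq.trans ?_ hk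
    exact congrArg₂ (· + ·) h1 h2

/-- The value of the residue on a family of labels at the edge `i`. -/
def triResidue (hm : 1 ≤ m) (i : Fin 3) : State (polygon 3) (TruncPoly m) {i} →ₗ[ℤ] ZMod m :=
  PiTensorProduct.lift
    { toFun := fun a => truncResidue hm (a (pairComp i)) (a (singleComp i))
      map_update_add' := by
        intro inst a c x y
        have h := pairComp_ne_singleComp i
        rcases eq_pairComp_or c with rfl | rfl
        · simp [Function.update_of_ne h.symm]
        · simp [Function.update_of_ne h]
      map_update_smul' := by
        intro inst a c n x
        have h := pairComp_ne_singleComp i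
        rcases eq_pairComp_or c with rfl | rfl
        · simp only [Function.update_self, Function.update_of_ne h.symm]
          exact map_zsmul ((truncResidue hm).flip (a (singleComp i))) n x
        · simp only [Function.update_self, Function.update_of_ne h]
          exact map_zsmul (truncResidue hm (a (pairComp i))) n x }

theorem triResidue_tprod (hm : 1 ≤ m) (i : Fin 3) (a : Comp (polygon 3) {i} → TruncPoly m) :
    triResidue hm i (PiTensorProduct.tprod ℤ a) =
      truncResidue hm (a (pairComp i)) (a (singleComp i)) := by
  rw [triResidue, PiTensorProduct.lift.tprod]; rfl

theorem triResidue_triMonomial (hm : 1 ≤ m) (i : Fin 3) {n : ℕ} (hn : n ≤ m) :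
    triResidue hm i (triMonomial m i n) = (n : ZMod m) := by
  rw [triMonomial, truncMonomial, triResidue_tprod, triExponents_pairComp,
    triExponents_singleComp, truncResidue_truncX hm (by omega)]

/-- The sum of the residues. -/
def labelsResidue (hm : 1 ≤ m) : Labels (polygon 3) (TruncPoly m) →ₗ[ℤ] ZMod m :=
  ∑ i, triResidue hm i ∘ₗ LinearMap.proj {i}

theorem labelsResidue_apply (hm : 1 ≤ m) (x : Labels (polygon 3) (TruncPoly m)) :
    labelsResidue hm x = ∑ i, triResidue hm i (x {i}) := by
  simp [labelsResidue]

/-- On a pure tensor this is the cyclic identity for its three labels: each edge multiplies two of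
them and pairs the product with the third. -/
theorem sum_triResidue_merge (hm : 1 ≤ m) (z : State (polygon 3) (TruncPoly m) ∅) :
    ∑ i, triResidue hm i (merge (polygon 3) (TruncPoly m) (Finset.empty_subset {i}) z) = 0 := by
  classical
  have key : ∑ i, triResidue hm i ∘ₗ
      merge (polygon 3) (TruncPoly m) (Finset.empty_subset {i}) = 0 := by
    ext a
    simp only [LinearMap.compMultilinearMap_apply, Fin.sum_univ_three, LinearMap.add_apply,
      LinearMap.comp_apply, LinearMap.zero_apply, merge_eq_tensorMap, tensorMap_tprod,
      triResidue_tprod, prod_fiber_pairComp, prod_fiber_singleComp]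
    exact truncResidue_cyclic hm _ _ _
  simpa using LinearMap.congr_fun key z

theorem labelsResidue_eq_zero (hm : 1 ≤ m) {x : Labels (polygon 3) (TruncPoly m)}
    (hx : x ∈ relCoboundaries (polygon 3) (TruncPoly m) ∅ Finset.univ 1) :
    labelsResidue hm x = 0 := by
  obtain ⟨z, hz⟩ := mem_relCoboundaries_triangle.1 hx
  rw [labelsResidue_apply, ← sum_triResidue_merge hm z]
  exact Finset.sum_congr rfl fun i _ => by rw [hz]

/-- The family of labels with a single monomial. -/
def triLabel (m : ℕ) (i : Fin 3) (n : ℕ) : Labels (polygon 3) (TruncPoly m) :=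
  Pi.single {i} (triMonomial m i n)

theorem triLabel_mem {i : Fin 3} {n : ℕ} (hn : n ≤ m) :
    triLabel m i n ∈ labelsDeg (polygon 3) (truncPolyDeg m) m := by
  intro s _
  rw [triLabel]
  by_cases hs : s = {i}
  · subst hs; rw [Pi.single_eq_same]; exact triMonomial_mem hn
  · rw [Pi.single_eq_of_ne hs]; exact zero_mem _

theorem labelsResidue_single (hm : 1 ≤ m) (i : Fin 3)
    (w : State (polygon 3) (TruncPoly m) {i}) :
    labelsResidue hm (Pi.single {i} w) = triResidue hm i w := by
  rw [labelsResidue_apply, Finset.sum_eq_single i]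
  · rw [Pi.single_eq_same]
  · intro j _ hj
    rw [Pi.single_eq_of_ne (by simpa using hj), map_zero]
  · simp

theorem single_apply_singleton {A : Type*} [CommRing A] (i j : Fin 3)
    (x : Labels (polygon 3) A) : (Pi.single {i} (x {i}) : Labels (polygon 3) A) {j} =
      if j = i then x {j} else 0 := by
  split_ifs with h
  · subst h; rw [Pi.single_eq_same]
  · rw [Pi.single_eq_of_ne (by simpa using h)]

/-- The sum is the coboundary of `x^a ⊗ x^b ⊗ x^c`: edge `i` isolates vertex `i + 2`, which explains
the order `c, a, b`. -/
theorem triLabel_relation {a b c : ℕ} (h : a + b + c = m) :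
    triLabel m 0 c + triLabel m 1 a + triLabel m 2 b ∈
      relCoboundaries (polygon 3) (TruncPoly m) ∅ Finset.univ 1 := by
  refine mem_relCoboundaries_triangle.2
    ⟨truncMonomial m fun v => ![a, b, c] (triVertexEquiv.symm v), fun i => ?_⟩
  rw [merge_truncMonomial]
  · have h1 : ∀ (i j : Fin 3) (n : ℕ), j ≠ i → triLabel m i n {j} = 0 := fun i j n hij =>
      Pi.single_eq_of_ne (by simpa using hij) _
    have h2 : ∀ (i : Fin 3) (n : ℕ), triLabel m i n {i} = triMonomial m i n := fun i n =>
      Pi.single_eq_same _ _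
    simp only [Equiv.symm_apply_apply, Pi.add_apply]
    fin_cases i
    · change triMonomial m 0 c = triLabel m 0 c {0} + triLabel m 1 a {0} + triLabel m 2 b {0}
      rw [h1 1 0 _ (by decide), h1 2 0 _ (by decide), h2, add_zero, add_zero]
    · change triMonomial m 1 a = triLabel m 0 c {1} + triLabel m 1 a {1} + triLabel m 2 b {1}
      rw [h1 0 1 _ (by decide), h1 2 1 _ (by decide), h2, zero_add, add_zero]
    · change triMonomial m 2 b = triLabel m 0 c {2} + triLabel m 1 a {2} + triLabel m 2 b {2}
      rw [h1 0 2 _ (by decide), h1 1 2 _ (by decide), h2, zero_add, zero_add]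
  · simp only [Equiv.symm_apply_apply]
    fin_cases i
    · change a + b + c = m; omega
    · change b + c + a = m; omega
    · change c + a + b = m; omega

/-- Homogeneous chains of degree `m` of the triangle are multiples of one of them, up to
coboundaries. -/
theorem exists_sub_zsmul_mem {x : Labels (polygon 3) (TruncPoly m)}
    (hx : x ∈ labelsDeg (polygon 3) (truncPolyDeg m) m) : ∃ n : ℤ,
      x - n • triLabel m 0 1 ∈ relCoboundaries (polygon 3) (TruncPoly m) ∅ Finset.univ 1 := by
  set W := relCoboundaries (polygon 3) (TruncPoly m) ∅ Finset.univ 1 with hW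
  have hU := eq_nsmul_of_cyclic_relation (m := m) (fun i n => W.mkQ (triLabel m i n))
    (fun i => by simp [triLabel, triMonomial_zero])
    (fun a b c h => by
      rw [← map_add, ← map_add, Submodule.mkQ_apply, Submodule.Quotient.mk_eq_zero]
      exact triLabel_relation h)
  have hsingle : ∀ i, ∀ w ∈ stateDeg (polygon 3) (truncPolyDeg m) {i} m,
      ∃ n : ℤ, W.mkQ (Pi.single {i} w) = n • W.mkQ (triLabel m 0 1) := by
    intro i w hw
    rw [stateDeg_eq, tensorDeg_truncPoly] at hw
    induction hw using Submodule.span_induction with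
    | zero => exact ⟨0, by simp⟩
    | add w w' _ _ h h' =>
      obtain ⟨n, hn⟩ := h
      obtain ⟨n', hn'⟩ := h'
      exact ⟨n + n', by rw [Pi.single_add, map_add, hn, hn', add_smul]⟩
    | smul l w _ h =>
      obtain ⟨n, hn⟩ := h
      exact ⟨l * n, by rw [Pi.single_smul, map_smul, hn, smul_smul]⟩
    | mem w hw =>
      obtain ⟨k, hk, rfl⟩ := hw
      rw [sum_comp_singleton] at hk
      refine ⟨(k (singleComp i) : ℤ), ?_⟩
      rw [natCast_zsmul, ← hU i (k (singleComp i)) (by omega), eq_triExponents hk,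
        triExponents_singleComp]
      rfl
  choose n hn using fun i => hsingle i (x {i}) (hx {i} trivial)
  refine ⟨∑ i, n i, ?_⟩
  -- Only the labels at the three singletons matter modulo `W`.
  have h1 : x - ∑ i, Pi.single {i} (x {i}) ∈ W := by
    refine mem_relCoboundaries_of_eq_zero fun t _ _ ht => ?_
    obtain ⟨j, rfl⟩ := Finset.card_eq_one.1 ht
    rw [Pi.sub_apply, Finset.sum_apply]
    simp [single_apply_singleton]
  rw [← Submodule.Quotient.mk_eq_zero, ← Submodule.mkQ_apply] at h1 ⊢
  rw [map_sub, sub_eq_zero, map_sum] at h1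
  rw [map_sub, h1, map_smul, Finset.sum_smul, sub_eq_zero]
  exact Finset.sum_congr rfl fun i _ => hn i

/-- The multiple is the class of `1 ⊗ x^m`, which is zero. -/
theorem nsmul_triLabel_mem :
    m • triLabel m 0 1 ∈ relCoboundaries (polygon 3) (TruncPoly m) ∅ Finset.univ 1 := by
  set W := relCoboundaries (polygon 3) (TruncPoly m) ∅ Finset.univ 1 with hW
  have hU := eq_nsmul_of_cyclic_relation (m := m) (fun i n => W.mkQ (triLabel m i n))
    (fun i => by simp [triLabel, triMonomial_zero])
    (fun a b c h => by
      rw [← map_add, ← map_add, Submodule.mkQ_apply, Submodule.Quotient.mk_eq_zero]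
      exact triLabel_relation h) 0 m le_rfl
  rw [← Submodule.Quotient.mk_eq_zero, ← Submodule.mkQ_apply, map_nsmul, ← hU]
  simp [triLabel, triMonomial_self]

/-- The residue descends to cohomology and sends the generator to `1`; since `m` kills the
generator, it is injective on the degree `m` part. -/
theorem nonempty_equiv_zmod (hm : 1 ≤ m) :
    Nonempty (relHDeg (polygon 3) (truncPolyDeg m) ∅ Finset.univ 1 m ≃ₗ[ℤ] ZMod m) := by
  set Z := relCocycles (polygon 3) (TruncPoly m) ∅ Finset.univ 1 with hZ
  set W := relCoboundaries (polygon 3) (TruncPoly m) ∅ Finset.univ 1 with hW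
  let L : (Z ⧸ W.submoduleOf Z) →ₗ[ℤ] ZMod m :=
    (W.submoduleOf Z).liftQ (labelsResidue hm ∘ₗ Z.subtype) fun x hx => labelsResidue_eq_zero hm hx
  have hL : ∀ x : Z, L (Submodule.Quotient.mk x) = labelsResidue hm x := fun x => rfl
  have hgen : labelsResidue hm (triLabel m 0 1) = 1 := by
    rw [triLabel, labelsResidue_single, triResidue_triMonomial hm 0 hm, Nat.cast_one]
  refine ⟨LinearEquiv.ofBijective
    (L.domRestrict (relHDeg (polygon 3) (truncPolyDeg m) ∅ Finset.univ 1 m)) ⟨?_, ?_⟩⟩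
  · rw [injective_iff_map_eq_zero]
    rintro ⟨_, ⟨x, hx, rfl⟩⟩ h0
    have h1 : labelsResidue hm (x : Labels (polygon 3) (TruncPoly m)) = 0 := h0
    obtain ⟨n, hn⟩ := exists_sub_zsmul_mem (x := (x : Labels (polygon 3) (TruncPoly m))) hx
    have h2 := labelsResidue_eq_zero hm hn
    rw [map_sub, h1, zero_sub, neg_eq_zero, map_smul, hgen, zsmul_one,
      ZMod.intCast_zmod_eq_zero_iff_dvd] at h2
    obtain ⟨l, rfl⟩ := h2
    have h3 := add_mem hn (Submodule.smul_mem _ l (nsmul_triLabel_mem (m := m)))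
    rw [← natCast_zsmul, smul_smul, mul_comm l, sub_add_cancel] at h3
    exact Subtype.ext ((Submodule.Quotient.mk_eq_zero _).2 h3)
  · intro r
    obtain ⟨n, rfl⟩ := ZMod.intCast_surjective r
    let w : Z := ⟨triLabel m 0 1, mem_relCocycles_triangle (triLabel_mem hm)⟩
    refine ⟨n • ⟨Submodule.Quotient.mk w, ⟨w, triLabel_mem hm, rfl⟩⟩, ?_⟩
    rw [map_smul]
    change n • labelsResidue hm (triLabel m 0 1) = _
    rw [hgen, zsmul_one]

end TriangleCohomology

end GraphCohomology

end

theorem mainTheorem11 {α β : Type*} [LinearOrder β] (G : Graph α β)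
    [Finite G.vertexSet] [Finite G.edgeSet] (v : ℕ) (hv : 3 ≤ v)
    (hG : GraphCohomology.IsPolygonWithDiagonals G v) :
    (∀ (A : Type*) [CommRing A] (𝒜 : ℕ → Submodule ℤ A) [GradedAlgebra 𝒜]
        [∀ i, Module.Free ℤ (𝒜 i)] [∀ i, Module.Finite ℤ (𝒜 i)],
      ∃ φ : GraphCohomology.H G A (v - 2) ≃ₗ[ℤ]
          GraphCohomology.H (GraphCohomology.polygon 3) A 1,
        ∀ j, (GraphCohomology.HDeg G 𝒜 (v - 2) j).map φ.toLinearMap =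
          GraphCohomology.HDeg (GraphCohomology.polygon 3) 𝒜 1 j) ∧
    ∀ m : ℕ, 1 ≤ m →
      Nonempty (GraphCohomology.HDeg G (GraphCohomology.truncPolyDeg m) (v - 2) m ≃ₗ[ℤ]
        ZMod m) := by
  refine ⟨fun A _ 𝒜 _ _ _ => GraphCohomology.gradedIso_of_isPolygonWithDiagonals hv hG 𝒜,
    fun m hm => ?_⟩
  obtain ⟨φ⟩ := ((GraphCohomology.gradedIso_of_isPolygonWithDiagonals hv hG
    (GraphCohomology.truncPolyDeg m)).trans (GraphCohomology.gradedIso_HDeg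
      (G := GraphCohomology.polygon 3) _ Finset.coe_univ 1).symm).nonempty_equiv m
  obtain ⟨ψ⟩ := GraphCohomology.nonempty_equiv_zmod hm
  exact ⟨φ.trans ψ⟩
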